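/- Let $\mathcal{L}^{+}$ (respectively $\mathcal{L}^{-}$) be the set of all entire functions $f:\mathbb{C}\to\mathbb{C}$ of the form $$f(z)=Cz^{l}e^{\alpha z}\prod_{j=1}^{\infty}(1+\beta_j z),\qquad C\in\mathbb{C},\ l\in\mathbb{N}_0,\ \beta_j\ge\beta_{j+1}\ge 0,\ \sum_{j}\beta_j<\infty,$$ with $\alpha\ge 0$ (respectively $\alpha<0$). For $b\ge 0$ let $\mathcal{A}_b$ be the set of entire functions $f$ with $\sup_{k\ge 0} d^{-k}|f^{(k)}(0)|<\infty$ for every $d>b$, and let $\mathcal{L}^{+}_b=\mathcal{L}^{+}\cap\mathcal{A}_b$. For $\theta\ge 0$ put $(\Delta_\theta f)(z)=\theta f'(z)+zf''(z)$ and $w_\theta(z)=\sum_{k\ge 0} \frac{z^k}{k!\,\Gamma(\theta+k)}$, where $1/\Gamma(0)=0$. For $a>0$ let $\exp(a\Delta_\theta)$ be the integral operator $$(\exp(a\Delta_\theta)f)(z)=e^{-z/a}\left(\delta_{\theta,0}\,f(0)+\int_0^\infty s^{\theta-1}e^{-s}\,w_\theta\!\left(\frac{sz}{a}\right)f(as)\,ds\right),$$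 where $\delta_{\theta,0}=1$ if $\theta=0$ and $\delta_{\theta,0}=0$ if $\theta>0$. Then, for every $a>0$ and $\theta\ge 0$: (i) if $0\le b<1/a$ and $c=b/(1-ab)$, then $\exp(a\Delta_\theta)$ maps $\mathcal{L}^{+}_b$ into $\mathcal{L}^{+}_c$. For $f\in\mathcal{L}^{+}_b$ the integral converges absolutely for every $z\in\mathbb{C}$, and $(\exp(a\Delta_\theta)f)(z)$ is the sum of the absolutely convergent double series $\sum_{k,m\ge 0}\frac{a^k}{k!}\frac{f^{(m)}(0)}{m!}\Delta_\theta^k z^m$; (ii) $\exp(a\Delta_\theta)$ maps the whole class $\mathcal{L}^{-}$ into $\mathcal{L}^{-}$; for $f\in\mathcal{L}^{-}$ the integral converges absolutely for every $z\in\mathbb{C}$. -/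

import Mathlib

open Set MeasureTheory

noncomputable section

/-- The space `ℬ_b` of entire functions `f` for which
`‖f‖_b = sup_k b^{-k} |f^{(k)}(0)|` is finite (used for `b > 0`). -/
def entireB (b : ℝ) : Set (ℂ → ℂ) :=
  {f | Differentiable ℂ f ∧
    BddAbove (range fun k : ℕ => (b ^ k)⁻¹ * ‖iteratedDeriv k f 0‖)}

/-- The space `𝒜_a = ⋂_{b > a} ℬ_b`, for `a ≥ 0`. -/
def entireA (a : ℝ) : Set (ℂ → ℂ) :=
  {f | ∀ b : ℝ, a < b → f ∈ entireB b}

/-- `f` is entire and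
`f(z) = C z^l exp(α z) ∏_j (1 + β_j z)` for some `C ∈ ℂ`, `l ∈ ℕ` and some nonincreasing summable
sequence `β_j ≥ 0`. (The product converges absolutely because `∑ β_j` does.) -/
def HasLaguerreForm (α : ℝ) (f : ℂ → ℂ) : Prop :=
  Differentiable ℂ f ∧
    ∃ (C : ℂ) (l : ℕ) (β : ℕ → ℝ), Antitone β ∧ (∀ j, 0 ≤ β j) ∧ Summable β ∧
      ∀ z : ℂ, f z = C * z ^ l * Complex.exp ((α : ℂ) * z) * ∏' j, (1 + (β j : ℂ) * z)

/-- The class `ℒ⁺` of Laguerre entire functions (`α ≥ 0`). -/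
def laguerrePlus : Set (ℂ → ℂ) := {f | ∃ α : ℝ, 0 ≤ α ∧ HasLaguerreForm α f}

/-- The class `ℒ⁻` (`α < 0`). -/
def laguerreMinus : Set (ℂ → ℂ) := {f | ∃ α : ℝ, α < 0 ∧ HasLaguerreForm α f}

/-- `ℒ⁺_b = ℒ⁺ ∩ 𝒜_b`. -/
def laguerrePlusIn (b : ℝ) : Set (ℂ → ℂ) := laguerrePlus ∩ entireA b

/-- `Δ_θ f = (θ + z D) D f = θ f' + z f''`. -/
def deltaOp (θ : ℝ) (f : ℂ → ℂ) : ℂ → ℂ :=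
  fun z => (θ : ℂ) * deriv f z + z * deriv (deriv f) z

/-- The term of index `(k, m)` of the double series
`∑_{k, m} (φ^{(k)}(0) / k!) (f^{(m)}(0) / m!) Δ_θ^k z^m` which defines `(φ(Δ_θ) f)(z)`. -/
def deltaSeriesTerm (θ : ℝ) (φ f : ℂ → ℂ) (z : ℂ) (p : ℕ × ℕ) : ℂ :=
  iteratedDeriv p.1 φ 0 / (p.1.factorial : ℂ) * (iteratedDeriv p.2 f 0 / (p.2.factorial : ℂ)) *
    ((deltaOp θ)^[p.1] fun w : ℂ => w ^ p.2) z

/-- `γ_θ(m) = m! Γ(θ + m)`. At the pole `θ = m = 0` Mathlib's `Real.Gamma 0` is `0`, so that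
`1 / γ_0(0)` is `0`, in accordance with `1 / Γ` being entire with a zero at `0`. -/
def gammaCoeff (θ : ℝ) (m : ℕ) : ℝ := (m.factorial : ℝ) * Real.Gamma (θ + m)

/-- `w_θ(z) = ∑_k z^k / γ_θ(k)`. -/
def wSeries (θ : ℝ) (z : ℂ) : ℂ := ∑' k : ℕ, z ^ k / (gammaCoeff θ k : ℂ)

/-- The integrand `s^{θ-1} e^{-s} w_θ(s z / a) f(a s)`, for `s > 0`. -/
def expDeltaIntegrand (a θ : ℝ) (f : ℂ → ℂ) (z : ℂ) (s : ℝ) : ℂ :=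
  ((s ^ (θ - 1) * Real.exp (-s) : ℝ) : ℂ) * wSeries θ ((s : ℂ) * z / (a : ℂ)) *
    f ((a : ℂ) * (s : ℂ))

/-- The integral operator `exp(a Δ_θ)`:
`e^{-z/a} ∫_0^∞ s^{θ-1} e^{-s} w_θ(s z / a) f(a s) ds` for `θ > 0`.
For `θ = 0` the `k = 0` part `s^{θ-1} / Γ(θ) ds` of the kernel is read as its weak limit as
`θ → 0+`, the unit mass at `s = 0`, which contributes the summand `f 0`; the parts `k ≥ 1` of the
kernel are given by the integral with `1 / γ_0(0) = 0`. -/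
def expDelta (a θ : ℝ) (f : ℂ → ℂ) (z : ℂ) : ℂ :=
  Complex.exp (-z / (a : ℂ)) *
    ((if θ = 0 then f 0 else 0) + ∫ s in Ioi (0 : ℝ), expDeltaIntegrand a θ f z s)

end

/-! Rescaling reduces the operator to a = 1. The Gamma moments of the kernel and the Chu–Vandermonde
identity give exp(Δ_θ) z^m as the Laguerre polynomial `lagPoly θ m`, with nonnegative coefficients.
If |f^{(m)}(0)| ≤ K d^m with d < 1, the binomial series makes every interchange of sums and integral
absolutely convergent and bounds the derivatives of the image at 0 by a multiple of (d/(1-d))^i.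
This gives the integral, the double series and the change of type (`integrable_and_hasSum_expDelta`,
`hasSum_lagCoeff`, `exists_hasSum_expDelta`).

The zeros are the substance. Multiplication by r + z before exp(Δ_θ) becomes r + z + θ + 2zD + Δ_θ
after it. With z = -y and F = e^{-y} P this is, up to sign and the factor e^y, yF'' + θF' - rF. A
positive solution u of yu'' + θu' = ru factors the latter as y^{1-θ} u^{-1} (y^θ u² (F/u)')'. Two
uses of Rolle's theorem, with extra zeros at infinity and at 0, turn n positive zeros of P into n +
1 (`exists_zeros_step`). So for θ > 0 a product of factors z and 1 + βz is mapped to a polynomial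
with simple negative zeros; θ = 0 is a limit.

Pointwise limits that do not vanish at 1 stay in ℒ⁺, by a compactness argument
(`HasShiftedForm.of_tendsto`). Hence genus zero functions, limits of their truncations, have images
in ℒ⁺, and the growth bound forces rate 0. A factor e^{αz} with aα < 1 is removed by a change of
variable (`expDelta_exp_mul`), which sends α to α/(1-aα). In (i) the type bounds α below 1/a; in
(ii) α < 0 suffices. -/

noncomputable section
open Polynomial Finset

/-! ### Rising factorials and Laguerre polynomials -/

/-- The rising factorial `(s)_m = s (s + 1) ⋯ (s + m - 1)`. -/
def rising (s : ℝ) (m : ℕ) : ℝ := (ascPochhammer ℝ m).eval s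

@[simp] lemma rising_zero (s : ℝ) : rising s 0 = 1 := by simp [rising]

lemma rising_succ (s : ℝ) (m : ℕ) : rising s (m + 1) = rising s m * (s + m) := by
  simp [rising, ascPochhammer_succ_eval]

lemma rising_succ_left (s : ℝ) (m : ℕ) : rising s (m + 1) = s * rising (s + 1) m := by
  simp [rising, ascPochhammer_succ_left]

lemma rising_nonneg {s : ℝ} (hs : 0 ≤ s) (m : ℕ) : 0 ≤ rising s m := by
  induction m with
  | zero => simp
  | succ m ih => rw [rising_succ]; positivity

lemma continuous_rising (m : ℕ) : Continuous fun s => rising s m :=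
  (ascPochhammer ℝ m).continuous

lemma Gamma_add_natCast {s : ℝ} (hs : 0 < s) (m : ℕ) :
    Real.Gamma (s + m) = rising s m * Real.Gamma s := by
  induction m with
  | zero => simp
  | succ m ih =>
    rw [rising_succ, Nat.cast_succ, ← add_assoc, Real.Gamma_add_one (by positivity), ih]
    ring

/-- The binomial series. -/
lemma hasSum_rising (s : ℝ) {x : ℝ} (hx : |x| < 1) :
    HasSum (fun m : ℕ => rising s m * x ^ m / m.factorial) (1 / (1 - x) ^ s) := by
  have h := (Real.one_div_one_sub_rpow_hasFPowerSeriesOnBall_zero s).hasSum (y := x)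
    (by simpa [enorm_eq_nnnorm] using! hx)
  simp only [FormalMultilinearSeries.ofScalars_apply_eq, zero_add, smul_eq_mul] at h
  refine h.congr_fun fun m => ?_
  have h1 := Ring.factorial_nsmul_multichoose_eq_ascPochhammer s m
  have h2 : Ring.choose (s + m - 1) m = Ring.multichoose s m := by
    rw [Ring.choose]; congr 1; ring
  rw [ascPochhammer_smeval_eq_eval] at h1
  rw [h2, rising, ← h1, nsmul_eq_mul]
  field_simp

/-- The coefficients of `exp(Δ_θ) z^m`. -/
def lagCoeff (θ : ℝ) (m i : ℕ) : ℝ := m.choose i * rising (θ + i) (m - i)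

lemma lagCoeff_nonneg {θ : ℝ} (hθ : 0 ≤ θ) (m i : ℕ) : 0 ≤ lagCoeff θ m i :=
  mul_nonneg (by positivity) (rising_nonneg (by positivity) _)

lemma lagCoeff_eq_zero (θ : ℝ) {m i : ℕ} (h : m < i) : lagCoeff θ m i = 0 := by
  simp [lagCoeff, Nat.choose_eq_zero_of_lt h]

lemma lagCoeff_succ_zero (θ : ℝ) (m : ℕ) :
    lagCoeff θ (m + 1) 0 = (θ + m) * lagCoeff θ m 0 := by
  simp [lagCoeff, rising_succ]; ring

lemma lagCoeff_succ_succ (θ : ℝ) (m i : ℕ) :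
    lagCoeff θ (m + 1) (i + 1) = (θ + m + (i + 1)) * lagCoeff θ m (i + 1) + lagCoeff θ m i := by
  rcases lt_trichotomy i m with h | rfl | h
  · obtain ⟨k, rfl⟩ := Nat.exists_eq_add_of_lt h
    simp only [lagCoeff, show i + k + 1 + 1 - (i + 1) = k + 1 by omega,
      show i + k + 1 - (i + 1) = k by omega, show i + k + 1 - i = k + 1 by omega]
    have h2 := Nat.choose_succ_right_eq (i + k + 1) i
    have h3 := Nat.choose_succ_succ (i + k + 1) i
    rw [show i + k + 1 - i = k + 1 by omega] at h2
    have h2' : ((i + k + 1).choose (i + 1) : ℝ) * (i + 1) = (i + k + 1).choose i * (k + 1) := by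
      exact_mod_cast h2
    rw [rising_succ_left (θ + i), rising_succ, h3]
    push_cast
    rw [show θ + (i + 1 : ℝ) = θ + i + 1 by ring]
    linear_combination (rising (θ + i + 1) k) * (- h2')
  · simp [lagCoeff]
  · rw [lagCoeff_eq_zero θ (by omega), lagCoeff_eq_zero θ (by omega), lagCoeff_eq_zero θ h]
    simp

lemma lagCoeff_recursion_zero (θ : ℝ) (m : ℕ) :
    lagCoeff θ (m + 1) 0 = θ * lagCoeff θ m 0 + θ * lagCoeff θ m 1 := by
  rw [lagCoeff_succ_zero]
  rcases m with - | m
  · simp [lagCoeff]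
  · simp [lagCoeff, rising_succ_left]; ring

/-- Unlike in `lagCoeff_succ_succ`, the factors here do not depend on `m`. So this is the
coefficient form of a fixed differential operator, namely `raiseOp`. -/
lemma lagCoeff_recursion_succ (θ : ℝ) (m i : ℕ) :
    lagCoeff θ (m + 1) (i + 1) = lagCoeff θ m i + (θ + 2 * (i + 1)) * lagCoeff θ m (i + 1) +
      (i + 2) * (θ + (i + 1)) * lagCoeff θ m (i + 2) := by
  rw [lagCoeff_succ_succ]
  rcases lt_trichotomy (i + 1) m with h | rfl | h
  · obtain ⟨k, rfl⟩ := Nat.exists_eq_add_of_lt h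
    simp only [lagCoeff, show i + 1 + k + 1 - (i + 1) = k + 1 by omega,
      show i + 1 + k + 1 - (i + 2) = k by omega]
    have h2 := Nat.choose_succ_right_eq (i + 1 + k + 1) (i + 1)
    rw [show i + 1 + k + 1 - (i + 1) = k + 1 by omega] at h2
    have h2' : ((i + 1 + k + 1).choose (i + 2) : ℝ) * (i + 2) =
        (i + 1 + k + 1).choose (i + 1) * (k + 1) := by exact_mod_cast h2
    rw [rising_succ_left]
    push_cast
    rw [show θ + (i + 2 : ℝ) = θ + (i + 1) + 1 by ring]
    linear_combination (-(θ + (i + 1)) * rising (θ + (i + 1) + 1) k) * h2'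
  · simp [lagCoeff]; ring
  · rw [lagCoeff_eq_zero θ h, lagCoeff_eq_zero θ (show m < i + 2 by omega)]; simp

/-- The Chu–Vandermonde identity. -/
lemma rising_add_natCast (θ : ℝ) (j m : ℕ) :
    rising (θ + j) m = ∑ i ∈ range (m + 1), lagCoeff θ m i * j.descFactorial i := by
  induction m with
  | zero => simp [lagCoeff]
  | succ m ih =>
    rw [rising_succ, ih, sum_range_succ' _ (m + 1)]
    -- The new factor θ + j + m is split as (θ + m + i) + (j - i); the second summand raises the
    -- falling factorial from i to i + 1.
    have h : ∀ i, lagCoeff θ (m + 1) (i + 1) * (j.descFactorial (i + 1) : ℝ) =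
        (θ + m + (i + 1)) * lagCoeff θ m (i + 1) * j.descFactorial (i + 1) +
        (j - i) * lagCoeff θ m i * j.descFactorial i := by
      intro i
      rw [lagCoeff_succ_succ]
      have : (j.descFactorial (i + 1) : ℝ) = (j - i) * j.descFactorial i := by
        rcases le_or_gt i j with hij | hij
        · rw [Nat.descFactorial_succ]; push_cast [hij]; ring
        · simp [Nat.descFactorial_eq_zero_iff_lt.2 hij]
      rw [add_mul, this]; ring
    rw [sum_congr rfl fun i _ => h i, sum_add_distrib]
    have h2 : ∑ i ∈ range (m + 1), (θ + m + ((i : ℝ) + 1)) * lagCoeff θ m (i + 1) *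
        (j.descFactorial (i + 1) : ℝ) + (θ + m) * lagCoeff θ m 0 =
        ∑ i ∈ range (m + 1), (θ + m + i) * lagCoeff θ m i * (j.descFactorial i : ℝ) := by
      have h3 := sum_range_succ' (fun i : ℕ => (θ + m + (i : ℝ)) * lagCoeff θ m i *
        (j.descFactorial i : ℝ)) (m + 1)
      rw [sum_range_succ] at h3
      simp only [lagCoeff_eq_zero θ (Nat.lt_succ_self m)] at h3
      simpa using h3.symm
    rw [lagCoeff_succ_zero, Nat.descFactorial_zero, Nat.cast_one, mul_one,
      add_right_comm (∑ i ∈ range (m + 1), _), h2,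
      ← sum_add_distrib, sum_mul]
    exact sum_congr rfl fun i _ => by ring

/-- `exp(Δ_θ) z^m` as a polynomial. -/
def lagPoly (θ : ℝ) (m : ℕ) : ℝ[X] := ∑ i ∈ range (m + 1), monomial i (lagCoeff θ m i)

lemma coeff_lagPoly (θ : ℝ) (m i : ℕ) : (lagPoly θ m).coeff i = lagCoeff θ m i := by
  simp only [lagPoly, finsetSum_coeff, coeff_monomial]
  rw [Finset.sum_ite_eq' (range (m + 1)) i]
  split_ifs with h
  · rfl
  · rw [lagCoeff_eq_zero]; simpa using h

/-- The operator `exp(Δ_θ) ∘ z ∘ exp(-Δ_θ)`. -/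
def raiseOp (θ : ℝ) (p : ℝ[X]) : ℝ[X] :=
  X * p + C θ * p + C 2 * (X * derivative p) + C θ * derivative p + X * derivative (derivative p)

lemma lagPoly_succ (θ : ℝ) (m : ℕ) : lagPoly θ (m + 1) = raiseOp θ (lagPoly θ m) := by
  ext i
  rcases i with - | i
  · simp [raiseOp, coeff_lagPoly, coeff_derivative, lagCoeff_recursion_zero]
  · simp only [raiseOp, coeff_lagPoly, coeff_derivative, coeff_add, coeff_C_mul, coeff_X_mul,
      lagCoeff_recursion_succ, Nat.cast_add, Nat.cast_one, show i + 1 + 1 = i + 2 from rfl]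
    ring

lemma aeval_lagPoly (θ : ℝ) (m : ℕ) (z : ℂ) :
    aeval z (lagPoly θ m) = ∑ i ∈ range (m + 1), (lagCoeff θ m i : ℂ) * z ^ i := by
  simp [lagPoly, aeval_monomial]

lemma hasSum_descFactorial (i : ℕ) (x : ℂ) :
    HasSum (fun j : ℕ => x ^ j / j.factorial * j.descFactorial i) (x ^ i * Complex.exp x) := by
  rw [← hasSum_nat_add_iff' i]
  have h0 : ∑ j ∈ range i, x ^ j / (j.factorial : ℂ) * (j.descFactorial i : ℂ) = 0 :=
    sum_eq_zero fun j hj => by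
      simp [Nat.descFactorial_eq_zero_iff_lt.2 (Finset.mem_range.1 hj)]
  rw [h0, sub_zero]
  have h := (NormedSpace.expSeries_div_hasSum_exp (𝔸 := ℂ) x).mul_left (x ^ i)
  rw [← Complex.exp_eq_exp_ℂ] at h
  refine h.congr_fun fun j => ?_
  have h1 := Nat.factorial_mul_descFactorial (Nat.le_add_left i j)
  rw [Nat.add_sub_cancel] at h1
  have h2 : ((j + i).factorial : ℂ) = j.factorial * (j + i).descFactorial i := by
    exact_mod_cast h1.symm
  have h3 : ((j + i).descFactorial i : ℂ) ≠ 0 := by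
    simp [Nat.descFactorial_eq_zero_iff_lt]
  rw [h2, pow_add]
  field_simp

/-- Chu–Vandermonde under the sum over j. The factor e^x is what the prefactor e^{-z/a} of the
operator cancels. -/
lemma hasSum_exp_mul_lagPoly (θ : ℝ) (m : ℕ) (x : ℂ) :
    HasSum (fun j : ℕ => x ^ j / j.factorial * (rising (θ + j) m : ℂ))
      (Complex.exp x * aeval x (lagPoly θ m)) := by
  have h := hasSum_sum (s := range (m + 1)) fun i _ =>
    (hasSum_descFactorial i x).mul_left (lagCoeff θ m i : ℂ)
  have h2 : ∑ i ∈ range (m + 1), (lagCoeff θ m i : ℂ) * (x ^ i * Complex.exp x) =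
      Complex.exp x * aeval x (lagPoly θ m) := by
    rw [aeval_lagPoly, mul_sum]
    exact sum_congr rfl fun i _ => by ring
  rw [← h2]
  refine h.congr_fun fun j => ?_
  rw [rising_add_natCast]
  push_cast
  rw [mul_sum]
  exact sum_congr rfl fun i _ => by ring
end

/-! ### Termwise integration of the kernel -/

noncomputable section
open Filter Topology

/-- The sum over the second index is a binomial series, (1-d)^{-θ-j}; what remains is an exponential
series in r/(1-d). -/
lemma summable_pow_div_factorial_mul_rising {θ d r : ℝ} (hθ : 0 ≤ θ) (hd : 0 ≤ d) (hd1 : d < 1)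
    (hr : 0 ≤ r) : Summable fun p : ℕ × ℕ =>
      r ^ p.1 / p.1.factorial * (rising (θ + p.1) p.2 * d ^ p.2 / p.2.factorial) := by
  have hb (j : ℕ) := hasSum_rising (θ + j) (x := d) (by rwa [abs_of_nonneg hd])
  have hpos (s : ℝ) (hs : 0 ≤ s) (m : ℕ) : 0 ≤ rising s m * d ^ m / m.factorial :=
    div_nonneg (mul_nonneg (rising_nonneg hs m) (by positivity)) (by positivity)
  have h1 : 0 < 1 - d := by linarith
  have h2 (j : ℕ) : HasSum (fun m : ℕ => r ^ j / j.factorial *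
      (rising (θ + j) m * d ^ m / m.factorial))
      (1 / (1 - d) ^ θ * ((r / (1 - d)) ^ j / j.factorial)) := by
    have h3 := (hb j).mul_left (r ^ j / j.factorial)
    rw [Real.rpow_add h1, Real.rpow_natCast] at h3
    have h4 : 1 / (1 - d) ^ θ * ((r / (1 - d)) ^ j / j.factorial) =
        r ^ j / j.factorial * (1 / ((1 - d) ^ θ * (1 - d) ^ j)) := by
      rw [div_pow]
      field_simp
    rwa [h4]
  refine (summable_prod_of_nonneg fun p => ?_).2 ⟨fun j => (h2 j).summable, ?_⟩
  · exact mul_nonneg (by positivity) (hpos _ (by positivity) _)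
  · simp only [fun j => (h2 j).tsum_eq]
    exact (Real.summable_pow_div_factorial _).mul_left _

/-- Termwise integration in which measurability and integrability of the sum are conclusions: it is
an a.e. limit of finite sums, dominated by the sum of the norms. -/
lemma integrable_and_hasSum_integral {α ι E : Type*} [MeasurableSpace α] {μ : Measure α}
    [Countable ι] [NormedAddCommGroup E] [NormedSpace ℝ E] [CompleteSpace E]
    {F : ι → α → E} {f : α → E} (hF : ∀ i, Integrable (F i) μ)
    (hs : Summable fun i => ∫ a, ‖F i a‖ ∂μ) (h : ∀ᵐ a ∂μ, HasSum (fun i => F i a) (f a)) :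
    Integrable f μ ∧ HasSum (fun i => ∫ a, F i a ∂μ) (∫ a, f a ∂μ) := by
  have hm : AEStronglyMeasurable f μ :=
    aestronglyMeasurable_of_tendsto_ae (u := (atTop : Filter (Finset ι)))
      (f := fun s a => ∑ i ∈ s, F i a)
      (fun s => Finset.aestronglyMeasurable_fun_sum s fun i _ => (hF i).1) h
  refine ⟨⟨hm, ?_⟩, ?_⟩
  · have h1 : ∑' i, ∫⁻ a, ‖F i a‖ₑ ∂μ < ⊤ := by
      have h2 (i : ι) : ∫⁻ a, ‖F i a‖ₑ ∂μ = ENNReal.ofReal (∫ a, ‖F i a‖ ∂μ) :=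
        (ofReal_integral_norm_eq_lintegral_enorm (hF i)).symm
      simp_rw [h2]
      exact hs.tsum_ofReal_lt_top
    rw [← lintegral_tsum fun i => (hF i).1.enorm] at h1
    refine (lintegral_mono_ae ?_).trans_lt h1
    filter_upwards [h] with a ha
    rw [← ha.tsum_eq]
    exact enorm_tsum_le_tsum_enorm
  · have h2 := hasSum_integral_of_summable_integral_norm hF hs
    rwa [integral_congr_ae (h.mono fun a ha => ha.tsum_eq)] at h2

lemma factorial_le_rising {s : ℝ} (hs : 1 ≤ s) (m : ℕ) : (m.factorial : ℝ) ≤ rising s m := by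
  induction m with
  | zero => simp
  | succ m ih =>
    rw [rising_succ, Nat.factorial_succ, Nat.cast_mul, mul_comm]
    push_cast
    exact mul_le_mul ih (by linarith) (by positivity) (ih.trans' (by positivity))

/-- Γ(θ + k) outgrows every geometric sequence. The index k = 0 is kept apart because of the pole at
θ = 0. -/
lemma exists_pow_div_Gamma_le {θ : ℝ} (hθ : 0 ≤ θ) (R : ℝ) (hR : 0 ≤ R) :
    ∃ M : ℝ, 0 ≤ M ∧ ∀ k : ℕ, R ^ k / Real.Gamma (θ + k) ≤ M := by
  have hG : 0 < Real.Gamma (θ + 1) := Real.Gamma_pos_of_pos (by linarith)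
  have hs := (Real.summable_pow_div_factorial R)
  have hb (k : ℕ) : R ^ k / k.factorial ≤ Real.exp R := by
    have := hs.le_tsum k fun j _ => by positivity
    rwa [← congrFun NormedSpace.exp_eq_tsum_div R, ← Real.exp_eq_exp_ℝ] at this
  refine ⟨max (1 / Real.Gamma θ) (R / Real.Gamma (θ + 1) * Real.exp R), ?_, fun k => ?_⟩
  · exact le_max_of_le_right (by positivity)
  rcases k with - | k
  · simp
  refine le_max_of_le_right ?_
  have h1 := Gamma_add_natCast (s := θ + 1) (by linarith) k
  rw [add_assoc, add_comm (1 : ℝ)] at h1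
  push_cast
  rw [h1]
  have h2 := factorial_le_rising (s := θ + 1) (by linarith) k
  have h3 : (0 : ℝ) < k.factorial := by positivity
  calc R ^ (k + 1) / (rising (θ + 1) k * Real.Gamma (θ + 1))
      ≤ R ^ (k + 1) / (k.factorial * Real.Gamma (θ + 1)) := by gcongr
    _ = R / Real.Gamma (θ + 1) * (R ^ k / k.factorial) := by field_simp; ring
    _ ≤ _ := by gcongr; exact hb k

lemma gammaCoeff_nonneg {θ : ℝ} (hθ : 0 ≤ θ) (m : ℕ) : 0 ≤ gammaCoeff θ m :=
  mul_nonneg (by positivity) (Real.Gamma_nonneg_of_nonneg (by positivity))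

lemma inv_gammaCoeff_le {θ : ℝ} (hθ : 0 ≤ θ) {R : ℝ} (hR : 0 < R) :
    ∃ M : ℝ, 0 ≤ M ∧ ∀ k : ℕ, (gammaCoeff θ k)⁻¹ ≤ M * ((R ^ k)⁻¹ / k.factorial) := by
  obtain ⟨M, hM, h⟩ := exists_pow_div_Gamma_le hθ R hR.le
  refine ⟨M, hM, fun k => ?_⟩
  have : (gammaCoeff θ k)⁻¹ = (R ^ k / Real.Gamma (θ + k)) * ((R ^ k)⁻¹ / k.factorial) := by
    rw [gammaCoeff]; field_simp
  rw [this]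
  exact mul_le_mul_of_nonneg_right (h k) (by positivity)

lemma summable_norm_wSeries {θ : ℝ} (hθ : 0 ≤ θ) (z : ℂ) :
    Summable fun k : ℕ => ‖z ^ k / (gammaCoeff θ k : ℂ)‖ := by
  obtain ⟨M, hM, h⟩ := inv_gammaCoeff_le hθ one_pos
  refine Summable.of_nonneg_of_le (fun _ => norm_nonneg _) (fun k => ?_)
    ((Real.summable_pow_div_factorial ‖z‖).mul_left M)
  rw [norm_div, norm_pow, Complex.norm_of_nonneg (gammaCoeff_nonneg hθ k), div_eq_mul_inv]
  refine (mul_le_mul_of_nonneg_left (h k) (by positivity)).trans (le_of_eq ?_)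
  simp; ring

/-- The moments `Γ(θ + j + m) / Γ(θ + j)`, with the value `0` at the pole `θ = j = 0`. -/
lemma Gamma_div_Gamma {θ : ℝ} (hθ : 0 ≤ θ) (j m : ℕ) :
    Real.Gamma (θ + j + m) / Real.Gamma (θ + j) = if θ + j = 0 then 0 else rising (θ + j) m := by
  split_ifs with h
  · simp [h]
  · have h0 : 0 < θ + j := lt_of_le_of_ne (by positivity) (Ne.symm h)
    rw [Gamma_add_natCast h0, mul_div_cancel_right₀ _ (Real.Gamma_pos_of_pos h0).ne']

section Monomial

variable {θ : ℝ} (hθ : 0 ≤ θ) (c : ℕ → ℂ) (z : ℂ)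

/-- The term of index `(j, m)` in the expansion of the integrand of `exp(Δ_θ)`. -/
def integrandTerm (θ : ℝ) (c : ℕ → ℂ) (z : ℂ) (p : ℕ × ℕ) (s : ℝ) : ℂ :=
  z ^ p.1 * c p.2 / (gammaCoeff θ p.1 : ℂ) *
    ((Real.exp (-s) * s ^ (θ + p.1 + p.2 - 1) : ℝ) : ℂ)

-- At θ = j = m = 0 the power s^{-1} is not integrable, but its coefficient 1/γ_0(0) is 0.
include hθ in
lemma integrandTerm_eq_zero (p : ℕ × ℕ) (h : θ + p.1 + p.2 = 0) :
    integrandTerm θ c z p = 0 := by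
  have h1 : (0 : ℝ) ≤ p.1 := by positivity
  have h2 : (0 : ℝ) ≤ p.2 := by positivity
  have h3 : θ = 0 := by linarith
  have h4 : (p.1 : ℝ) = 0 := by linarith
  ext s
  simp [integrandTerm, gammaCoeff, h3, h4]

include hθ in
lemma integrable_integrandTerm (p : ℕ × ℕ) :
    IntegrableOn (integrandTerm θ c z p) (Ioi 0) := by
  rcases eq_or_lt_of_le (show 0 ≤ θ + p.1 + p.2 by positivity) with h | h
  · rw [integrandTerm_eq_zero hθ c z p h.symm]; exact integrableOn_zero
  · exact ((Real.GammaIntegral_convergent h).ofReal).const_mul _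

include hθ in
lemma integral_integrandTerm (p : ℕ × ℕ) :
    ∫ s in Ioi (0 : ℝ), integrandTerm θ c z p s = z ^ p.1 / p.1.factorial * c p.2 *
      ((if θ + p.1 = 0 then 0 else rising (θ + p.1) p.2 : ℝ) : ℂ) := by
  rw [← Gamma_div_Gamma hθ]
  rcases eq_or_lt_of_le (show 0 ≤ θ + p.1 + p.2 by positivity) with h | h
  · rw [integrandTerm_eq_zero hθ c z p h.symm, ← h]; simp
  · simp only [integrandTerm]
    rw [integral_const_mul, integral_complex_ofReal, ← Real.Gamma_eq_integral h, gammaCoeff]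
    push_cast
    ring

include hθ in
lemma integral_norm_integrandTerm (p : ℕ × ℕ) :
    ∫ s in Ioi (0 : ℝ), ‖integrandTerm θ c z p s‖ = ‖z‖ ^ p.1 / p.1.factorial * ‖c p.2‖ *
      (if θ + p.1 = 0 then 0 else rising (θ + p.1) p.2) := by
  -- The norm of a term is the same term for ‖c‖ and ‖z‖, so the moment formula applies again.
  have h := integral_integrandTerm hθ (fun m => (‖c m‖ : ℂ)) (‖z‖ : ℂ) p
  have h2 : ∫ s in Ioi (0 : ℝ), integrandTerm θ (fun m => (‖c m‖ : ℂ)) (‖z‖ : ℂ) p s =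
      ((∫ s in Ioi (0 : ℝ), ‖integrandTerm θ c z p s‖ : ℝ) : ℂ) := by
    rw [← integral_complex_ofReal]
    refine setIntegral_congr_fun measurableSet_Ioi fun s hs => ?_
    have hs' : 0 ≤ s := le_of_lt hs
    simp only [integrandTerm, norm_mul, norm_div, norm_pow,
      Complex.norm_of_nonneg (gammaCoeff_nonneg hθ p.1)]
    rw [Complex.norm_of_nonneg (by positivity)]
    push_cast
    rfl
  rw [h2] at h
  exact_mod_cast h

end Monomial

section Expansion

variable {θ K d : ℝ} {c : ℕ → ℂ} {f : ℂ → ℂ} (hθ : 0 ≤ θ) (hd : 0 ≤ d) (hd1 : d < 1)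
  (hc : ∀ m, ‖c m‖ ≤ K * (d ^ m / m.factorial)) (hf : ∀ z, HasSum (fun m => c m * z ^ m) (f z))

include hθ hd hd1 hc in
lemma summable_kernel_terms (z : ℂ) : Summable fun p : ℕ × ℕ =>
    ‖z‖ ^ p.1 / p.1.factorial * ‖c p.2‖ * rising (θ + p.1) p.2 := by
  refine Summable.of_nonneg_of_le (fun p => ?_) (fun p => ?_)
    ((summable_pow_div_factorial_mul_rising hθ hd hd1 (norm_nonneg z)).mul_left K)
  · exact mul_nonneg (by positivity) (rising_nonneg (by positivity) _)
  · have h1 := rising_nonneg (show 0 ≤ θ + (p.1 : ℝ) by positivity) p.2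
    calc ‖z‖ ^ p.1 / p.1.factorial * ‖c p.2‖ * rising (θ + p.1) p.2
        ≤ ‖z‖ ^ p.1 / p.1.factorial * (K * (d ^ p.2 / p.2.factorial)) * rising (θ + p.1) p.2 := by
          gcongr; exact hc _
      _ = _ := by ring

include hf in
lemma summable_norm_of_hasSum (z : ℂ) : Summable fun m => ‖c m * z ^ m‖ :=
  (hf z).summable.norm

include hθ hf in
lemma hasSum_integrandTerm (z : ℂ) {s : ℝ} (hs : 0 < s) :
    HasSum (fun p => integrandTerm θ c z p s) (expDeltaIntegrand 1 θ f z s) := by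
  have h1 := summable_norm_wSeries hθ ((s : ℂ) * z / (1 : ℝ))
  have h2 := summable_norm_of_hasSum hf (((1 : ℝ) : ℂ) * (s : ℂ))
  have h3 : HasSum (fun p : ℕ × ℕ => ((s : ℂ) * z / (1 : ℝ)) ^ p.1 / (gammaCoeff θ p.1 : ℂ) *
      (c p.2 * (((1 : ℝ) : ℂ) * (s : ℂ)) ^ p.2))
      (wSeries θ ((s : ℂ) * z / (1 : ℝ)) * f (((1 : ℝ) : ℂ) * (s : ℂ))) := by
    rw [← (hf _).tsum_eq, wSeries, tsum_mul_tsum_of_summable_norm h1 h2]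
    exact (summable_mul_of_summable_norm h1 h2).hasSum
  have h4 (p : ℕ × ℕ) : s ^ (θ + p.1 + p.2 - 1) = s ^ (θ - 1) * s ^ p.1 * s ^ p.2 := by
    rw [show θ + p.1 + p.2 - 1 = (θ - 1) + p.1 + p.2 by ring, Real.rpow_add hs,
      Real.rpow_add hs, Real.rpow_natCast, Real.rpow_natCast]
  have h5 : expDeltaIntegrand 1 θ f z s = ((s ^ (θ - 1) * Real.exp (-s) : ℝ) : ℂ) *
      (wSeries θ ((s : ℂ) * z / (1 : ℝ)) * f (((1 : ℝ) : ℂ) * (s : ℂ))) := by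
    rw [expDeltaIntegrand, mul_assoc]
  rw [h5]
  refine (h3.mul_left _).congr_fun fun p => ?_
  simp only [integrandTerm, h4]
  push_cast
  simp only [div_one, one_mul, mul_pow]
  ring

include hθ hd hd1 hc hf in
lemma integrable_and_hasSum_expDelta (z : ℂ) :
    IntegrableOn (expDeltaIntegrand 1 θ f z) (Ioi 0) ∧
    HasSum (fun p : ℕ × ℕ => z ^ p.1 / p.1.factorial * c p.2 * (rising (θ + p.1) p.2 : ℂ))
      ((if θ = 0 then f 0 else 0) + ∫ s in Ioi (0 : ℝ), expDeltaIntegrand 1 θ f z s) := by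
  have hs : Summable fun p => ∫ s in Ioi (0 : ℝ), ‖integrandTerm θ c z p s‖ := by
    refine Summable.of_nonneg_of_le (fun p => by positivity) (fun p => ?_)
      (summable_kernel_terms hθ hd hd1 hc z)
    rw [integral_norm_integrandTerm hθ]
    have := rising_nonneg (show 0 ≤ θ + (p.1 : ℝ) by positivity) p.2
    gcongr
    split_ifs <;> simp [this]
  have h := integrable_and_hasSum_integral (integrable_integrandTerm hθ c z) hs
    ((ae_restrict_iff' measurableSet_Ioi).2 <| .of_forall fun s hs =>
      hasSum_integrandTerm hθ hf z hs)
  refine ⟨h.1, ?_⟩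
  -- For θ = 0 the integral loses the row j = 0. There the rising factorial (0)_m vanishes for m >
  -- 0, so only the entry (0, 0) is missing, and `f 0` supplies it.
  have h2 : HasSum (fun p : ℕ × ℕ => if p = 0 then (if θ = 0 then f 0 else 0) else 0)
      (if θ = 0 then f 0 else 0) := hasSum_ite_eq 0 _
  refine (h2.add h.2).congr_fun fun p => ?_
  rw [integral_integrandTerm hθ]
  have hf0 : f 0 = c 0 := by
    refine (hf 0).unique ?_
    simpa using hasSum_single (f := fun m => c m * (0 : ℂ) ^ m) 0 fun m hm => by simp [hm]
  rcases p with ⟨j, m⟩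
  by_cases h0 : θ + j = 0
  · have hj : (j : ℝ) = 0 := by have : (0 : ℝ) ≤ j := by positivity
                                linarith
    have hj' : j = 0 := by exact_mod_cast hj
    subst hj'
    have hθ0 : θ = 0 := by simpa using h0
    subst hθ0
    rcases m with - | m
    · simp [hf0]
    · simp [rising_succ_left, Prod.ext_iff]
  · rcases eq_or_ne ((j, m) : ℕ × ℕ) 0 with h | h
    · have : j = 0 := congrArg Prod.fst h
      subst this
      have : θ ≠ 0 := by simpa using h0
      simp [this]
    · simp [h, h0]

include hθ hd hd1 hc hf in
lemma hasSum_lagPoly (z : ℂ) :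
    HasSum (fun m => c m * Polynomial.aeval z (lagPoly θ m)) (expDelta 1 θ f z) := by
  have h := (integrable_and_hasSum_expDelta hθ hd hd1 hc hf z).2
  rw [← (Equiv.prodComm ℕ ℕ).hasSum_iff] at h
  have h2 := (h.prod_fiberwise (g := fun m => c m * (Complex.exp z *
    Polynomial.aeval z (lagPoly θ m))) fun m => by
      refine ((hasSum_exp_mul_lagPoly θ m z).mul_left (c m)).congr_fun fun j => ?_
      simp only [Function.comp_apply, Equiv.prodComm_apply, Prod.swap_prod_mk]
      ring).mul_left (Complex.exp (-z))
  have h3 : expDelta 1 θ f z = Complex.exp (-z) * ((if θ = 0 then f 0 else 0) +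
      ∫ s in Ioi (0 : ℝ), expDeltaIntegrand 1 θ f z s) := by simp [expDelta]
  rw [h3]
  refine h2.congr_fun fun m => ?_
  have : Complex.exp (-z) * Complex.exp z = 1 := by rw [← Complex.exp_add]; simp
  linear_combination (- c m * Polynomial.aeval z (lagPoly θ m)) * this

include hθ hd hd1 hc in
lemma summable_lagCoeff (z : ℂ) : Summable fun p : ℕ × ℕ =>
    ‖c (p.1 + p.2) * (lagCoeff θ (p.1 + p.2) p.1 : ℂ) * z ^ p.1‖ := by
  refine Summable.of_nonneg_of_le (fun p => norm_nonneg _) (fun p => ?_)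
    ((summable_pow_div_factorial_mul_rising hθ hd hd1
      (show 0 ≤ d * ‖z‖ by positivity)).mul_left K)
  rcases p with ⟨i, k⟩
  have h1 := rising_nonneg (show 0 ≤ θ + (i : ℝ) by positivity) k
  rw [norm_mul, norm_mul, norm_pow, Complex.norm_of_nonneg (lagCoeff_nonneg hθ _ _)]
  have h2 := lagCoeff_nonneg hθ (i + k) i
  calc ‖c (i + k)‖ * lagCoeff θ (i + k) i * ‖z‖ ^ i
      ≤ (K * (d ^ (i + k) / (i + k).factorial)) * lagCoeff θ (i + k) i * ‖z‖ ^ i := by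
        gcongr; exact hc _
    _ = _ := by
        have h3 : ((i + k).factorial : ℝ) = (i + k).choose i * i.factorial * k.factorial := by
          rw [Nat.choose_symm_add]
          exact_mod_cast (Nat.add_choose_mul_factorial_mul_factorial i k).symm
        have h4 : (0 : ℝ) < (i + k).choose i := by
          exact_mod_cast Nat.choose_pos (Nat.le_add_right i k)
        simp only [lagCoeff, h3, Nat.add_sub_cancel_left, pow_add, mul_pow]
        field_simp

-- The triangle i ≤ m is indexed by (i, m - i). Absolute convergence in this form yields both the
-- Taylor coefficients of the image (sum over the second index) and the double operator series.
include hθ hd hd1 hc hf in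
lemma hasSum_lagCoeff (z : ℂ) : HasSum (fun p : ℕ × ℕ =>
    c (p.1 + p.2) * (lagCoeff θ (p.1 + p.2) p.1 : ℂ) * z ^ p.1) (expDelta 1 θ f z) := by
  have hs := (summable_lagCoeff hθ hd hd1 hc z).of_norm
  have hinj : Function.Injective fun p : ℕ × ℕ => (p.1 + p.2, p.1) := by
    rintro ⟨a, b⟩ ⟨a', b'⟩ h
    simp only [Prod.mk.injEq] at h ⊢
    omega
  have hsupp : ∀ q ∉ Set.range fun p : ℕ × ℕ => (p.1 + p.2, p.1),
      c q.1 * (lagCoeff θ q.1 q.2 : ℂ) * z ^ q.2 = 0 := by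
    rintro ⟨m, i⟩ hq
    rw [lagCoeff_eq_zero]
    · simp
    · by_contra hlt
      exact hq ⟨(i, m - i), by simp at hlt ⊢; omega⟩
  have h1 := (hinj.hasSum_iff hsupp).1 hs.hasSum
  have h2 : HasSum (fun m => c m * Polynomial.aeval z (lagPoly θ m)) _ :=
    h1.prod_fiberwise fun m => by
      rw [aeval_lagPoly, Finset.mul_sum]
      refine (hasSum_sum_of_ne_finset_zero (s := Finset.range (m + 1)) fun i hi => ?_).congr_fun
        fun i => mul_assoc _ _ _
      rw [lagCoeff_eq_zero θ (by simpa using hi)]; simp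
  rw [(hasSum_lagPoly hθ hd hd1 hc hf z).unique h2]
  exact hs.hasSum

end Expansion
end

/-! ### Rolle's theorem and the differential equation of w_θ -/

noncomputable section
open Filter Topology

/-- Rolle's theorem on a half-line. -/
lemma exists_hasDerivAt_eq_zero_Ioi {φ φ' : ℝ → ℝ} {a : ℝ} (hc : ContinuousOn φ (Ici a))
    (hd : ∀ x, a < x → HasDerivAt φ (φ' x) x) (h0 : φ a = 0) (hlim : Tendsto φ atTop (𝓝 0)) :
    ∃ ξ, a < ξ ∧ φ' ξ = 0 := by
  wlog hpos : 0 ≤ φ (a + 1) generalizing φ φ'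
  · obtain ⟨ξ, h1, h2⟩ := this (φ := fun x => -φ x) (φ' := fun x => -φ' x) hc.neg
      (fun x hx => (hd x hx).neg) (by simp [h0]) (by simpa using hlim.neg) (by linarith)
    exact ⟨ξ, h1, by simpa using h2⟩
  rcases hpos.eq_or_lt with h | h
  · obtain ⟨ξ, h1, h2⟩ := exists_hasDerivAt_eq_zero (f := φ) (f' := φ') (by linarith : a < a + 1)
      (hc.mono Icc_subset_Ici_self) (by rw [h0, h]) (fun x hx => hd x hx.1)
    exact ⟨ξ, h1.1, h2⟩
  -- Half the positive value at a + 1 is attained on both sides of a + 1; Rolle's theorem applies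
  -- between the two points.
  · obtain ⟨b, hb1, hb2⟩ := ((hlim.eventually (gt_mem_nhds (half_pos h))).and
      (eventually_gt_atTop (a + 1))).exists
    obtain ⟨p, hp, hp'⟩ := intermediate_value_Icc (by linarith : a ≤ a + 1)
      (hc.mono Icc_subset_Ici_self) (show φ (a + 1) / 2 ∈ Icc (φ a) (φ (a + 1)) by
        constructor <;> linarith)
    obtain ⟨q, hq, hq'⟩ := intermediate_value_Icc' hb2.le
      (hc.mono (Icc_subset_Ici_self.trans (Ici_subset_Ici.2 (by linarith))))
      (show φ (a + 1) / 2 ∈ Icc (φ b) (φ (a + 1)) by constructor <;> linarith)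
    have hpne : p ≠ a + 1 := by rintro rfl; linarith
    have hpq : p < q := lt_of_lt_of_le (lt_of_le_of_ne hp.2 hpne) hq.1
    obtain ⟨ξ, h1, h2⟩ := exists_hasDerivAt_eq_zero (f := φ) (f' := φ') hpq
      (hc.mono fun x hx => hp.1.trans hx.1) (by rw [hp', hq'])
      (fun x hx => hd x (hp.1.trans_lt hx.1))
    exact ⟨ξ, hp.1.trans_lt h1.1, h2⟩

/-- The zero at infinity makes up for the zero that Rolle's theorem loses: n zeros give n critical
points. -/
lemma exists_interlacing_zeros {φ φ' : ℝ → ℝ} {a : ℝ} {n : ℕ} {y : ℕ → ℝ}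
    (hya : ∀ i < n, a ≤ y i) (hy : ∀ i, i + 1 < n → y i < y (i + 1))
    (hc : ContinuousOn φ (Ici a)) (hd : ∀ x, a < x → HasDerivAt φ (φ' x) x)
    (h0 : ∀ i < n, φ (y i) = 0) (hlim : Tendsto φ atTop (𝓝 0)) :
    ∃ ξ : ℕ → ℝ, ∀ i < n, y i < ξ i ∧ φ' (ξ i) = 0 ∧ (i + 1 < n → ξ i < y (i + 1)) := by
  have h : ∀ i, ∃ x, i < n → y i < x ∧ φ' x = 0 ∧ (i + 1 < n → x < y (i + 1)) := by
    intro i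
    by_cases hi : i < n
    · by_cases hi' : i + 1 < n
      · obtain ⟨x, h1, h2⟩ := exists_hasDerivAt_eq_zero (f := φ) (f' := φ') (hy i hi')
          (hc.mono fun x hx => (hya i hi).trans hx.1) (by rw [h0 i hi, h0 _ hi'])
          (fun x hx => hd x ((hya i hi).trans_lt hx.1))
        exact ⟨x, fun _ => ⟨h1.1, h2, fun _ => h1.2⟩⟩
      · obtain ⟨x, h1, h2⟩ := exists_hasDerivAt_eq_zero_Ioi (φ := φ) (φ' := φ') (a := y i)
          (hc.mono (Ici_subset_Ici.2 (hya i hi))) (fun x hx => hd x ((hya i hi).trans_lt hx))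
          (h0 i hi) hlim
        exact ⟨x, fun _ => ⟨h1, h2, fun h => absurd h hi'⟩⟩
    · exact ⟨0, fun h => absurd h hi⟩
  exact ⟨fun i => (h i).choose, fun i hi => (h i).choose_spec hi⟩

/-- The restriction of `w_θ` to the real line. -/
def wReal (θ x : ℝ) : ℝ := ∑' k : ℕ, x ^ k / gammaCoeff θ k

lemma summable_norm_wReal {θ : ℝ} (hθ : 0 ≤ θ) (x : ℝ) :
    Summable fun k : ℕ => ‖x ^ k / gammaCoeff θ k‖ := by
  simpa using summable_norm_wSeries hθ (x : ℂ)

lemma gammaCoeff_succ (θ : ℝ) (k : ℕ) :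
    gammaCoeff θ (k + 1) = (k + 1) * gammaCoeff (θ + 1) k := by
  simp only [gammaCoeff, Nat.factorial_succ]
  push_cast
  rw [show θ + 1 + (k : ℝ) = θ + (k + 1) by ring]
  ring

lemma hasDerivAt_wReal {θ : ℝ} (hθ : 0 ≤ θ) (x : ℝ) :
    HasDerivAt (wReal θ) (wReal (θ + 1) x) x := by
  set R := |x| + 1 with hR
  have hterm (k : ℕ) (y : ℝ) : ((k + 1 : ℕ) : ℝ) * y ^ k / gammaCoeff θ (k + 1) =
      y ^ k / gammaCoeff (θ + 1) k := by
    rw [gammaCoeff_succ]; push_cast; field_simp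
  have hu : Summable fun k : ℕ => (k : ℝ) * R ^ (k - 1) / gammaCoeff θ k := by
    rw [← summable_nat_add_iff 1]
    refine ((summable_norm_wReal (θ := θ + 1) (by linarith) R).of_norm).congr fun k => ?_
    rw [Nat.add_sub_cancel, hterm]
  have h := hasDerivAt_tsum_of_isPreconnected (𝕜 := ℝ) (t := Metric.ball (0 : ℝ) R)
    (g := fun (k : ℕ) y => y ^ k / gammaCoeff θ k)
    (g' := fun (k : ℕ) y => (k : ℝ) * y ^ (k - 1) / gammaCoeff θ k) (y₀ := 0) (y := x)
    hu Metric.isOpen_ball (convex_ball 0 R).isPreconnected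
    (fun k y _ => (hasDerivAt_pow k y).div_const _) (fun k y hy => by
      rw [norm_div, norm_mul, norm_pow, Real.norm_of_nonneg (gammaCoeff_nonneg hθ k),
        Real.norm_of_nonneg (Nat.cast_nonneg k)]
      have hy' : ‖y‖ ≤ R := by simpa using (mem_ball_zero_iff.1 hy).le
      have := gammaCoeff_nonneg hθ k
      gcongr)
    (by simp [hR]; positivity) (summable_norm_wReal hθ 0).of_norm (by simp [hR])
  have h2 : ∑' k : ℕ, (k : ℝ) * x ^ (k - 1) / gammaCoeff θ k = wReal (θ + 1) x := by
    have hs : Summable fun k : ℕ => (k : ℝ) * x ^ (k - 1) / gammaCoeff θ k := by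
      rw [← summable_nat_add_iff 1]
      refine ((summable_norm_wReal (θ := θ + 1) (by linarith) x).of_norm).congr fun k => ?_
      rw [Nat.add_sub_cancel, hterm]
    rw [hs.tsum_eq_zero_add, wReal]
    simp only [Nat.cast_zero, zero_mul, zero_div, zero_add]
    exact tsum_congr fun k => by rw [Nat.add_sub_cancel, hterm]
  rw [h2] at h
  exact h

/-- Since w_θ' = w_{θ+1}, this is the differential equation x w'' + θ w' = w. -/
lemma wReal_recursion {θ : ℝ} (hθ : 0 < θ) (x : ℝ) :
    x * wReal (θ + 2) x + θ * wReal (θ + 1) x = wReal θ x := by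
  have h0 := (summable_norm_wReal hθ.le x).of_norm
  have h1 := (summable_norm_wReal (θ := θ + 1) (by linarith) x).of_norm
  have h2 := (summable_norm_wReal (θ := θ + 2) (by linarith) x).of_norm
  rw [wReal, wReal, wReal, h0.tsum_eq_zero_add, h1.tsum_eq_zero_add, ← tsum_mul_left, mul_add,
    ← tsum_mul_left, ← add_assoc, add_right_comm,
    ← (h2.mul_left x).tsum_add (((summable_nat_add_iff 1).2 h1).mul_left θ), add_comm]
  congr 1
  · simp only [gammaCoeff, Nat.factorial_zero, pow_zero, Nat.cast_zero, add_zero,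
      Real.Gamma_add_one hθ.ne']
    field_simp
  · refine tsum_congr fun k => ?_
    have hk : θ + k + 1 ≠ 0 := by positivity
    have hG : Real.Gamma (θ + k + 1) ≠ 0 := (Real.Gamma_pos_of_pos (by positivity)).ne'
    have e1 : gammaCoeff (θ + 2) k = k.factorial * ((θ + k + 1) * Real.Gamma (θ + k + 1)) := by
      rw [gammaCoeff, ← Real.Gamma_add_one hk]; ring_nf
    have e2 : gammaCoeff (θ + 1) (k + 1) =
        (k + 1) * k.factorial * ((θ + k + 1) * Real.Gamma (θ + k + 1)) := by
      rw [gammaCoeff, ← Real.Gamma_add_one hk, Nat.factorial_succ]; push_cast; ring_nf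
    have e3 : gammaCoeff θ (k + 1) = (k + 1) * k.factorial * Real.Gamma (θ + k + 1) := by
      rw [gammaCoeff, Nat.factorial_succ]; push_cast; ring_nf
    rw [e1, e2, e3]
    field_simp
    ring

lemma le_wReal {θ : ℝ} (hθ : 0 ≤ θ) {x : ℝ} (hx : 0 ≤ x) : 1 / Real.Gamma θ ≤ wReal θ x := by
  have := (summable_norm_wReal hθ x).of_norm.le_tsum 0 fun k _ =>
    div_nonneg (by positivity) (gammaCoeff_nonneg hθ k)
  simpa [gammaCoeff, wReal] using this

/-- w_θ grows slower than every exponential, so e^{-x} dominates it in the limits at infinity below.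
-/
lemma exists_wReal_le {θ : ℝ} (hθ : 0 ≤ θ) {R : ℝ} (hR : 0 < R) :
    ∃ M : ℝ, 0 ≤ M ∧ ∀ x, 0 ≤ x → wReal θ x ≤ M * Real.exp (x / R) := by
  obtain ⟨M, hM, h⟩ := inv_gammaCoeff_le hθ hR
  refine ⟨M, hM, fun x hx => ?_⟩
  rw [Real.exp_eq_exp_ℝ, NormedSpace.exp_eq_tsum_div, ← tsum_mul_left, wReal]
  refine (summable_norm_wReal hθ x).of_norm.tsum_le_tsum (fun k => ?_)
    ((Real.summable_pow_div_factorial _).mul_left M)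
  rw [div_eq_mul_inv]
  refine (mul_le_mul_of_nonneg_left (h k) (by positivity)).trans (le_of_eq ?_)
  rw [div_pow]; field_simp

open Polynomial in
lemma tendsto_eval_mul_exp_neg (P : ℝ[X]) {b : ℝ} (hb : 0 < b) :
    Tendsto (fun x => P.eval x * Real.exp (-(b * x))) atTop (𝓝 0) := by
  have h := (Polynomial.tendsto_div_exp_atTop (P.comp (C b⁻¹ * X))).comp
    (tendsto_id.const_mul_atTop hb)
  refine h.congr fun x => ?_
  simp only [Function.comp_apply, id, eval_comp, eval_mul, eval_C, eval_X]
  rw [inv_mul_cancel_left₀ hb.ne', Real.exp_neg, div_eq_mul_inv]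

open Polynomial in
/-- If `P` has `n` distinct positive zeros, then so does `e^y (y D² + θ D - r) (e^{-y} P)`, with
`n + 1` in place of `n`. -/
lemma exists_zeros_step {θ r : ℝ} (hθ : 0 < θ) (hr : 0 ≤ r) (P : ℝ[X]) {n : ℕ} {y : ℕ → ℝ}
    (hpos : ∀ i < n, 0 < y i) (hy : ∀ i, i + 1 < n → y i < y (i + 1))
    (hP : ∀ i < n, P.eval (y i) = 0) :
    ∃ η : ℕ → ℝ, (∀ i < n + 1, 0 < η i) ∧ (∀ i, i + 1 < n + 1 → η i < η (i + 1)) ∧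
      ∀ i < n + 1, η i * ((derivative (derivative P)).eval (η i) - 2 * (derivative P).eval (η i) +
        P.eval (η i)) + θ * ((derivative P).eval (η i) - P.eval (η i)) - r * P.eval (η i) = 0 := by
  set P1 := derivative P with hP1
  set P2 := derivative P1 with hP2
  let F : ℝ → ℝ := fun x => P.eval x * Real.exp (-x)
  let F1 : ℝ → ℝ := fun x => (P1 - P).eval x * Real.exp (-x)
  let F2 : ℝ → ℝ := fun x => (P2 - 2 * P1 + P).eval x * Real.exp (-x)
  -- The positive solution of x u'' + θ u' = r u through which the second-order operator is
  -- factored.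
  let u : ℝ → ℝ := fun x => wReal θ (r * x)
  let u1 : ℝ → ℝ := fun x => r * wReal (θ + 1) (r * x)
  let u2 : ℝ → ℝ := fun x => r * (r * wReal (θ + 1 + 1) (r * x))
  have hexp (x : ℝ) : HasDerivAt (fun x : ℝ => Real.exp (-x)) (-Real.exp (-x)) x := by
    simpa using (hasDerivAt_neg x).exp
  have hF (x : ℝ) : HasDerivAt F (F1 x) x := by
    refine ((P.hasDerivAt x).mul (hexp x)).congr_deriv ?_
    simp only [F1, eval_sub]; ring
  have hF1 (x : ℝ) : HasDerivAt F1 (F2 x) x := by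
    refine (((P1 - P).hasDerivAt x).mul (hexp x)).congr_deriv ?_
    simp only [F2, eval_sub, eval_add, eval_mul, derivative_sub, ← hP2, ← hP1, eval_ofNat]; ring
  have hlin (x : ℝ) : HasDerivAt (fun x : ℝ => r * x) r x := by
    simpa using (hasDerivAt_id x).const_mul r
  have hu (x : ℝ) : HasDerivAt u (u1 x) x := by
    refine ((hasDerivAt_wReal hθ.le (r * x)).comp x (hlin x)).congr_deriv ?_
    simp only [u1]; ring
  have hu1 (x : ℝ) : HasDerivAt u1 (u2 x) x := by
    refine (((hasDerivAt_wReal (θ := θ + 1) (by linarith) (r * x)).comp x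
      (hlin x)).const_mul r).congr_deriv ?_
    simp only [u2]; ring
  have hode (x : ℝ) : x * u2 x + θ * u1 x = r * u x := by
    have := wReal_recursion hθ (r * x)
    simp only [u, u1, u2, show θ + 1 + 1 = θ + 2 by ring, ← this]
    ring
  have hG : 0 < Real.Gamma θ := Real.Gamma_pos_of_pos hθ
  have hulow (x : ℝ) (hx : 0 ≤ x) : 1 / Real.Gamma θ ≤ u x := le_wReal hθ.le (by positivity)
  have hupos (x : ℝ) (hx : 0 ≤ x) : 0 < u x := lt_of_lt_of_le (by positivity) (hulow x hx)
  -- the first application of Rolle's theorem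
  obtain ⟨ξ, hξ⟩ := exists_interlacing_zeros (φ := fun x => F x / u x)
    (φ' := fun x => (F1 x * u x - F x * u1 x) / u x ^ 2) (a := 0) (fun i hi => (hpos i hi).le) hy
    (fun x hx => ((hF x).div (hu x) (hupos x hx).ne').continuousAt.continuousWithinAt)
    (fun x hx => (hF x).div (hu x) (hupos x hx.le).ne')
    (fun i hi => by simp [F, hP i hi]) (by
      have h1 := ((tendsto_eval_mul_exp_neg P one_pos).abs).mul_const (Real.Gamma θ)
      rw [abs_zero, zero_mul] at h1
      refine squeeze_zero_norm' ?_ h1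
      filter_upwards [eventually_ge_atTop 0] with x hx
      have h2 := hulow x hx
      rw [norm_div, Real.norm_of_nonneg (hupos x hx).le, one_mul, div_eq_mul_inv]
      refine mul_le_mul_of_nonneg_left ?_ (abs_nonneg _)
      rw [inv_le_comm₀ (hupos x hx) hG]
      simpa using h2)
  have hwr (i : ℕ) (hi : i < n) : F1 (ξ i) * u (ξ i) - F (ξ i) * u1 (ξ i) = 0 := by
    have h1 := (hξ i hi).2.1
    have h2 : u (ξ i) ≠ 0 := (hupos _ ((hpos i hi).trans (hξ i hi).1).le).ne'
    simpa [h2] using h1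
  -- the second application, to the weighted Wronskian, which also vanishes at the origin
  let η : ℕ → ℝ := fun i => Nat.casesOn (motive := fun _ => ℝ) i 0 ξ
  -- R = 2r + 1 makes rx/R ≤ x/2, so e^{-x} leaves two factors e^{-x/4}: one for x^θ, one for the
  -- polynomials.
  obtain ⟨M, hM, hMu⟩ := exists_wReal_le hθ.le (R := 2 * r + 1) (by positivity)
  obtain ⟨M1, hM1, hMu1⟩ := exists_wReal_le (θ := θ + 1) (by linarith) (R := 2 * r + 1)
    (by positivity)
  have hexpR (x : ℝ) (hx : 0 ≤ x) : Real.exp (r * x / (2 * r + 1)) ≤ Real.exp (x / 2) := by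
    refine Real.exp_le_exp.2 ?_
    rw [div_le_div_iff₀ (by positivity) (by positivity)]
    nlinarith
  obtain ⟨ζ, hζ⟩ := exists_interlacing_zeros (n := n + 1) (y := η)
    (φ := fun x => x ^ θ * (F1 x * u x - F x * u1 x))
    (φ' := fun x => θ * x ^ (θ - 1) * (F1 x * u x - F x * u1 x) +
      x ^ θ * ((F2 x * u x + F1 x * u1 x) - (F1 x * u1 x + F x * u2 x))) (a := 0)
    (fun i hi => by
      rcases i with - | i
      · exact le_rfl
      · exact ((hpos i (by omega)).trans (hξ i (by omega)).1).le)
    (fun i hi => by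
      rcases i with - | i
      · exact (hpos 0 (by omega)).trans (hξ 0 (by omega)).1
      · exact ((hξ i (by omega)).2.2 (by omega)).trans (hξ (i + 1) (by omega)).1)
    (by
      refine ContinuousOn.mul (Real.continuous_rpow_const hθ.le).continuousOn ?_
      exact fun x _ => (((hF1 x).mul (hu x)).sub
        ((hF x).mul (hu1 x))).continuousAt.continuousWithinAt)
    (fun x hx => (Real.hasDerivAt_rpow_const (Or.inl hx.ne')).mul
      (((hF1 x).mul (hu x)).sub ((hF x).mul (hu1 x))))
    (fun i hi => by
      rcases i with - | i
      · simp [η, Real.zero_rpow hθ.ne']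
      · simp [η, hwr i (by omega)])
    (by
      have t1 := tendsto_rpow_mul_exp_neg_mul_atTop_nhds_zero θ (1 / 4) (by norm_num)
      have t2 := ((tendsto_eval_mul_exp_neg (P1 - P) (b := 1 / 4) (by norm_num)).abs.mul_const
        M).add ((tendsto_eval_mul_exp_neg P (b := 1 / 4) (by norm_num)).abs.mul_const (r * M1))
      have t3 := t1.mul t2
      simp only [abs_zero, zero_mul, add_zero] at t3
      refine squeeze_zero_norm' ?_ t3
      filter_upwards [eventually_ge_atTop 0] with x hx
      have hrx : 0 ≤ r * x := by positivity
      have a1 : u x ≤ M * Real.exp (x / 2) :=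
        (hMu _ hrx).trans (mul_le_mul_of_nonneg_left (hexpR x hx) hM)
      have a2 : u1 x ≤ r * (M1 * Real.exp (x / 2)) :=
        mul_le_mul_of_nonneg_left ((hMu1 _ hrx).trans
          (mul_le_mul_of_nonneg_left (hexpR x hx) hM1)) hr
      have a3 : 0 ≤ u1 x := mul_nonneg hr (((one_div_pos.2
        (Real.Gamma_pos_of_pos (show 0 < θ + 1 by linarith))).le.trans
          (le_wReal (by linarith) hrx)))
      rw [norm_mul, Real.norm_of_nonneg (Real.rpow_nonneg hx θ), mul_assoc (x ^ θ)]
      refine mul_le_mul_of_nonneg_left ?_ (Real.rpow_nonneg hx θ)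
      refine (norm_sub_le _ _).trans ?_
      have e3 : ‖F1 x * u x‖ = |F1 x| * u x := by
        rw [Real.norm_eq_abs, abs_mul, abs_of_pos (hupos x hx)]
      have e4 : ‖F x * u1 x‖ = |F x| * u1 x := by
        rw [Real.norm_eq_abs, abs_mul, abs_of_nonneg a3]
      rw [e3, e4]
      have e1 : Real.exp (-x) * Real.exp (x / 2) =
          Real.exp (-(1 / 4 * x)) * Real.exp (-(1 / 4 * x)) := by
        rw [← Real.exp_add, ← Real.exp_add]; ring_nf
      have e2 : Real.exp (-(1 / 4) * x) = Real.exp (-(1 / 4 * x)) := by ring_nf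
      simp only [F1, F, abs_mul, Real.abs_exp, e2]
      calc _ ≤ |eval x (P1 - P)| * Real.exp (-x) * (M * Real.exp (x / 2)) +
            |eval x P| * Real.exp (-x) * (r * (M1 * Real.exp (x / 2))) := by gcongr
        _ = |eval x (P1 - P)| * M * (Real.exp (-x) * Real.exp (x / 2)) +
            |eval x P| * (r * M1) * (Real.exp (-x) * Real.exp (x / 2)) := by ring
        _ = _ := by rw [e1]; ring)
  have hζpos (i : ℕ) (hi : i < n + 1) : 0 < ζ i := by
    refine lt_of_le_of_lt ?_ (hζ i hi).1
    rcases i with - | i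
    · exact le_rfl
    · exact ((hpos i (by omega)).trans (hξ i (by omega)).1).le
  refine ⟨ζ, hζpos, fun i hi => ((hζ i (by omega)).2.2 hi).trans (hζ (i + 1) hi).1,
    fun i hi => ?_⟩
  have h1 := (hζ i hi).2.1
  have hx := hζpos i hi
  set x := ζ i
  have h2 : x ^ θ = x * x ^ (θ - 1) := by
    rw [Real.rpow_sub_one hx.ne']; field_simp
  rw [h2] at h1
  -- The mixed terms F'u' cancel and u'' is eliminated by the differential equation, which leaves u
  -- as a nonzero factor.
  have h3 : x ^ (θ - 1) * u x * Real.exp (-x) * (x * (P2.eval x - 2 * P1.eval x + P.eval x) +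
      θ * (P1.eval x - P.eval x) - r * P.eval x) = 0 := by
    rw [← h1]
    simp only [F, F1, F2, eval_sub, eval_add, eval_mul, eval_ofNat]
    linear_combination (-(x ^ (θ - 1)) * Real.exp (-x) * P.eval x) * (- hode x)
  have h4 : x ^ (θ - 1) * u x * Real.exp (-x) ≠ 0 := by
    have := hupos x hx.le
    positivity
  exact (mul_eq_zero.1 h3).resolve_left h4
end

/-! ### The operator on real polynomials and its negative zeros -/

noncomputable section
open Filter Topology Polynomial

/-- `exp(Δ_θ)` on real polynomials. -/
def expPoly (θ : ℝ) : ℝ[X] →ₗ[ℝ] ℝ[X] :=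
  Polynomial.lsum fun m => LinearMap.toSpanSingleton ℝ ℝ[X] (lagPoly θ m)

lemma expPoly_monomial (θ : ℝ) (m : ℕ) (a : ℝ) :
    expPoly θ (monomial m a) = a • lagPoly θ m := by
  simp [expPoly, Polynomial.lsum_apply, sum_monomial_index]

lemma expPoly_apply (θ : ℝ) (p : ℝ[X]) :
    expPoly θ p = ∑ m ∈ Finset.range (p.natDegree + 1), p.coeff m • lagPoly θ m := by
  conv_lhs => rw [p.as_sum_range]
  simp [expPoly_monomial]

lemma raiseOp_add (θ : ℝ) (p q : ℝ[X]) : raiseOp θ (p + q) = raiseOp θ p + raiseOp θ q := by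
  simp only [raiseOp, derivative_add]; ring

lemma raiseOp_smul (θ a : ℝ) (p : ℝ[X]) : raiseOp θ (a • p) = a • raiseOp θ p := by
  simp only [raiseOp, smul_eq_C_mul, derivative_C_mul]; ring

/-- The intertwining relation that lets linear factors be adjoined one at a time after applying
exp(Δ_θ). -/
lemma expPoly_X_mul (θ : ℝ) (p : ℝ[X]) : expPoly θ (X * p) = raiseOp θ (expPoly θ p) := by
  induction p using Polynomial.induction_on' with
  | add p q hp hq => rw [mul_add, map_add, map_add, raiseOp_add, hp, hq]
  | monomial m a =>
    rw [X_mul_monomial, expPoly_monomial, expPoly_monomial, raiseOp_smul, lagPoly_succ]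

lemma exists_coeff_bound (p : ℝ[X]) {d : ℝ} (hd : 0 < d) :
    ∃ K, ∀ m, ‖(p.coeff m : ℂ)‖ ≤ K * (d ^ m / m.factorial) := by
  refine ⟨∑ m ∈ p.support, |p.coeff m| / (d ^ m / m.factorial), fun m => ?_⟩
  have h0 : 0 < d ^ m / m.factorial := by positivity
  rw [Complex.norm_real, ← div_le_iff₀ h0]
  by_cases hm : m ∈ p.support
  · exact Finset.single_le_sum (f := fun m : ℕ => |p.coeff m| / (d ^ m / m.factorial))
      (fun i _ => by positivity) hm
  · rw [notMem_support_iff.1 hm]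
    simp only [norm_zero, zero_div]
    exact Finset.sum_nonneg fun i _ => by positivity

lemma hasSum_coeff (p : ℝ[X]) (z : ℂ) :
    HasSum (fun m => (p.coeff m : ℂ) * z ^ m) (aeval z p) := by
  rw [aeval_eq_sum_range]
  simp only [Complex.real_smul]
  refine hasSum_sum_of_ne_finset_zero fun m hm => ?_
  rw [coeff_eq_zero_of_natDegree_lt (by simpa using hm)]; simp

lemma integrable_expDeltaIntegrand_aeval {θ : ℝ} (hθ : 0 ≤ θ) (p : ℝ[X]) (z : ℂ) :
    IntegrableOn (expDeltaIntegrand 1 θ (fun z => aeval z p) z) (Ioi 0) := by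
  obtain ⟨K, hK⟩ := exists_coeff_bound p (d := 1 / 2) (by norm_num)
  exact (integrable_and_hasSum_expDelta hθ (by norm_num) (by norm_num) hK (hasSum_coeff p) z).1

lemma expDelta_aeval {θ : ℝ} (hθ : 0 ≤ θ) (p : ℝ[X]) (z : ℂ) :
    expDelta 1 θ (fun z => aeval z p) z = aeval z (expPoly θ p) := by
  obtain ⟨K, hK⟩ := exists_coeff_bound p (d := 1 / 2) (by norm_num)
  have h := hasSum_lagPoly hθ (by norm_num) (by norm_num) hK (hasSum_coeff p) z
  refine h.unique ?_
  rw [expPoly_apply, map_sum]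
  simp only [map_smul, Complex.real_smul]
  refine hasSum_sum_of_ne_finset_zero fun m hm => ?_
  rw [coeff_eq_zero_of_natDegree_lt (by simpa using hm)]; simp

/-- `p` has degree `n` and `n` distinct negative zeros. -/
def HasNegRoots (p : ℝ[X]) (n : ℕ) : Prop :=
  p ≠ 0 ∧ p.natDegree = n ∧ ∃ y : ℕ → ℝ, (∀ i < n, 0 < y i) ∧
    (∀ i, i + 1 < n → y i < y (i + 1)) ∧ ∀ i < n, p.eval (-(y i)) = 0

lemma coeff_raiseOp_succ (θ r : ℝ) (p : ℝ[X]) (i : ℕ) :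
    (C r * p + raiseOp θ p).coeff (i + 1) = p.coeff i +
      (r + θ + 2 * (i + 1)) * p.coeff (i + 1) + (i + 2) * (θ + (i + 1)) * p.coeff (i + 2) := by
  simp only [raiseOp, coeff_derivative, coeff_add, coeff_C_mul, coeff_X_mul,
    Nat.cast_add, Nat.cast_one, show i + 1 + 1 = i + 2 from rfl]
  ring

/-- The substitution z = -y turns the operator, up to sign, into the one of `exists_zeros_step`.
Only X * p reaches degree n + 1, so the n + 1 zeros found there are all zeros. -/
lemma HasNegRoots.raise {θ r : ℝ} (hθ : 0 < θ) (hr : 0 ≤ r) {p : ℝ[X]} {n : ℕ}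
    (h : HasNegRoots p n) : HasNegRoots (C r * p + raiseOp θ p) (n + 1) := by
  obtain ⟨hp, hdeg, y, hpos, hy, hroot⟩ := h
  have hz (k : ℕ) (hk : n < k) : p.coeff k = 0 := coeff_eq_zero_of_natDegree_lt (by omega)
  have hc : (C r * p + raiseOp θ p).coeff (n + 1) ≠ 0 := by
    rw [coeff_raiseOp_succ, hz (n + 1) (by omega), hz (n + 2) (by omega), ← hdeg]
    simpa using hp
  refine ⟨fun h0 => hc (by rw [h0, coeff_zero]), natDegree_eq_of_le_of_coeff_ne_zero ?_ hc, ?_⟩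
  · rw [natDegree_le_iff_coeff_eq_zero]
    intro k hk
    obtain ⟨i, rfl⟩ := Nat.exists_eq_add_of_lt hk
    rw [coeff_raiseOp_succ, hz _ (by omega), hz _ (by omega), hz _ (by omega)]
    simp
  · obtain ⟨η, h1, h2, h3⟩ := exists_zeros_step hθ hr (p.comp (-X)) hpos hy
      (fun i hi => by simpa using hroot i hi)
    refine ⟨η, h1, h2, fun i hi => ?_⟩
    have h4 := h3 i hi
    simp only [derivative_comp, derivative_mul, derivative_neg, derivative_X, eval_add, eval_mul,
      eval_comp, eval_neg, eval_X, eval_one, derivative_one, neg_zero, eval_zero] at h4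
    simp only [raiseOp, eval_add, eval_mul, eval_C, eval_X]
    linear_combination - h4

lemma HasNegRoots.smul {p : ℝ[X]} {n : ℕ} (h : HasNegRoots p n) {a : ℝ} (ha : a ≠ 0) :
    HasNegRoots (a • p) n := by
  obtain ⟨hp, hdeg, y, hpos, hy, hroot⟩ := h
  exact ⟨smul_ne_zero ha hp, by rw [natDegree_smul _ ha, hdeg], y, hpos, hy,
    fun i hi => by simp [hroot i hi]⟩

lemma HasNegRoots.eq_prod {p : ℝ[X]} {n : ℕ} (h : HasNegRoots p n) :
    ∃ y : ℕ → ℝ, (∀ i < n, 0 < y i) ∧ (∀ i, i + 1 < n → y i < y (i + 1)) ∧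
      p = C p.leadingCoeff * ∏ i ∈ Finset.range n, (X + C (y i)) := by
  obtain ⟨hp, hdeg, y, hpos, hy, hroot⟩ := h
  refine ⟨y, hpos, hy, ?_⟩
  have hlt : ∀ j < n, ∀ i < j, y i < y j := by
    intro j
    induction j with
    | zero => simp
    | succ j ih =>
      intro hj i hi
      rcases Nat.lt_succ_iff_lt_or_eq.1 hi with h | rfl
      · exact (ih (by omega) i h).trans (hy j hj)
      · exact hy i hj
  have hmon : (∏ i ∈ Finset.range n, (X + C (y i))).Monic :=
    monic_prod_of_monic _ _ fun i _ => monic_X_add_C _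
  refine eq_leadingCoeff_mul_of_monic_of_dvd_of_natDegree_le hmon ?_ ?_
  · refine Finset.prod_dvd_of_coprime ?_ fun i hi => ?_
    · intro i hi j hj hij
      have hne : -y i ≠ -y j := by
        rw [Ne, neg_inj]
        simp only [Finset.coe_range, mem_Iio] at hi hj
        rcases lt_or_gt_of_ne hij with h | h
        · exact (hlt j hj i h).ne
        · exact (hlt i hi j h).ne'
      have := isCoprime_X_sub_C_of_isUnit_sub (sub_ne_zero.2 hne).isUnit
      simpa using this
    · have := dvd_iff_isRoot.2 (hroot i (Finset.mem_range.1 hi))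
      simpa using this
  · rw [natDegree_prod_of_monic _ _ fun i _ => monic_X_add_C _, hdeg]
    simp

/-- Products of linear factors with nonpositive real zeros. -/
lemma exists_hasNegRoots_expPoly {θ : ℝ} (hθ : 0 < θ) (l N : ℕ) (β : ℕ → ℝ) (hβ : ∀ j, 0 ≤ β j) :
    ∃ n, HasNegRoots (expPoly θ (X ^ l * ∏ j ∈ Finset.range N, (1 + C (β j) * X))) n := by
  induction N with
  | zero =>
    induction l with
    | zero =>
      refine ⟨0, ?_⟩
      have : expPoly θ (X ^ 0 * ∏ j ∈ Finset.range 0, (1 + C (β j) * X)) = 1 := by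
        have := expPoly_monomial θ 0 1
        simpa [lagPoly, lagCoeff] using this
      rw [this]
      exact ⟨one_ne_zero, natDegree_one, 0, by simp, by simp, by simp⟩
    | succ l ih =>
      obtain ⟨n, hn⟩ := ih
      refine ⟨n + 1, ?_⟩
      have := hn.raise hθ le_rfl
      rwa [← expPoly_X_mul, C_0, zero_mul, zero_add, ← mul_assoc, ← pow_succ'] at this
  | succ N ih =>
    obtain ⟨n, hn⟩ := ih
    rw [Finset.prod_range_succ]
    rcases (hβ N).eq_or_lt with h | h
    · exact ⟨n, by simpa [← h] using hn⟩
    · refine ⟨n + 1, ?_⟩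
      -- 1 + βz = β(β⁻¹ + z), hence r = β⁻¹.
      have h1 := (hn.raise hθ (inv_pos.2 h).le).smul h.ne'
      convert h1 using 1
      rw [← expPoly_X_mul, show ∀ a : ℝ, ∀ q : ℝ[X], C a * expPoly θ q = expPoly θ (C a * q) from
        fun a q => by rw [← smul_eq_C_mul, ← map_smul, smul_eq_C_mul], ← map_add, ← map_smul]
      congr 1
      have h2 : C (β N) * C (β N)⁻¹ = (1 : ℝ[X]) := by rw [← C_mul, mul_inv_cancel₀ h.ne', C_1]
      rw [smul_eq_C_mul]
      linear_combination (-(X ^ l * ∏ j ∈ Finset.range N, (1 + C (β j) * X))) * h2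

/-- For the passage θ → 0+: the Rolle argument needs θ > 0, both for the zero of x^θ at 0 and for
u(0) > 0. -/
lemma continuous_aeval_expPoly (p : ℝ[X]) (z : ℂ) :
    Continuous fun θ => aeval z (expPoly θ p) := by
  simp only [expPoly_apply, map_sum, map_smul, aeval_lagPoly, lagCoeff]
  refine continuous_finsetSum _ fun m _ => ?_
  refine (continuous_finsetSum _ fun i _ => ?_).const_smul (p.coeff m)
  refine (Complex.continuous_ofReal.comp ?_).mul continuous_const
  exact continuous_const.mul ((continuous_rising _).comp (continuous_id.add continuous_const))
end

/-! ### Compactness of the class ℒ⁺ -/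

noncomputable section
open Filter Topology Polynomial

/-- The normal form of a function in `ℒ⁺` around the point `1`. -/
def HasShiftedForm (F : ℂ → ℂ) : Prop :=
  ∃ (K : ℂ) (α : ℝ) (t : ℕ → ℝ), 0 ≤ α ∧ Antitone t ∧ (∀ i, 0 ≤ t i) ∧ (∀ i, t i ≤ 1) ∧
    Summable t ∧ ∀ z, F z = K * Complex.exp (α * (z - 1)) * ∏' i, (1 + (t i : ℂ) * (z - 1))

lemma multipliable_one_add_ofReal_mul {t : ℕ → ℝ} (h : Summable t) (u : ℂ) :
    Multipliable fun i => 1 + (t i : ℂ) * u :=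
  multipliable_one_add_of_summable (by simpa using h.abs.mul_right ‖u‖)

lemma HasNegRoots.hasShiftedForm {p : ℝ[X]} {n : ℕ} (h : HasNegRoots p n) :
    HasShiftedForm fun z => aeval z p := by
  obtain ⟨y, hpos, hy, hp⟩ := h.eq_prod
  have hfin : ∀ i ∉ Finset.range n, (if i < n then 1 / (1 + y i) else 0 : ℝ) = 0 :=
    fun i hi => if_neg (by simpa using hi)
  -- z + y = (1 + y)(1 + t(z - 1)) with t = 1/(1 + y), which lies in (0, 1). Zeros near the origin
  -- give t near 1, so they cause no loss of compactness.
  refine ⟨p.leadingCoeff * ∏ i ∈ Finset.range n, (1 + (y i : ℂ)), 0,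
    fun i => if i < n then 1 / (1 + y i) else 0, le_rfl, antitone_nat_of_succ_le fun i => ?_,
    fun i => ?_, fun i => ?_, summable_of_ne_finset_zero hfin, fun z => ?_⟩
  · by_cases h1 : i + 1 < n
    · have := hpos i (by omega)
      have := hy i h1
      rw [if_pos h1, if_pos (by omega)]
      gcongr
    · rw [if_neg h1]
      split_ifs with h2
      · have := hpos i h2
        positivity
      · exact le_rfl
  · dsimp only
    split_ifs with h2
    · have := hpos i h2
      positivity
    · exact le_rfl
  · dsimp only
    split_ifs with h2
    · have := hpos i h2
      rw [div_le_one (by linarith)]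
      linarith
    · exact zero_le_one
  · rw [tprod_eq_prod (s := Finset.range n) fun i hi => by dsimp only; rw [hfin i hi]; simp]
    conv_lhs => rw [hp]
    dsimp only
    rw [map_mul, map_prod, aeval_C, Complex.ofReal_zero, zero_mul, Complex.exp_zero, mul_one,
      mul_assoc, ← Finset.prod_mul_distrib]
    congr 1
    refine Finset.prod_congr rfl fun i hi => ?_
    have hi' := Finset.mem_range.1 hi
    have h0 : (1 + (y i : ℂ)) ≠ 0 := by
      have := hpos i hi'
      exact_mod_cast (show (1 + y i : ℝ) ≠ 0 by positivity)
    rw [if_pos hi']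
    push_cast
    simp only [map_add, aeval_X, aeval_C, Complex.coe_algebraMap]
    field_simp
    ring

/-- The primary factor `(1 + x) e^{-x}`, minus `1`. -/
def primaryFactor (x : ℂ) : ℂ := (1 + x) * Complex.exp (-x) - 1

lemma norm_primaryFactor_le (x : ℂ) : ‖primaryFactor x‖ ≤ 2 * Real.exp ‖x‖ * ‖x‖ ^ 2 := by
  have h2 := Complex.norm_exp_sub_sum_le_norm_mul_exp (-x) 2
  have h1 := Complex.norm_exp_sub_sum_le_norm_mul_exp (-x) 1
  simp [Finset.sum_range_succ] at h1 h2
  have h3 : primaryFactor x = (Complex.exp (-x) - (1 + -x)) + x * (Complex.exp (-x) - 1) := by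
    rw [primaryFactor]; ring
  rw [h3]
  refine (norm_add_le _ _).trans ?_
  rw [norm_mul]
  have h4 := mul_le_mul_of_nonneg_left h1 (norm_nonneg x)
  calc _ ≤ ‖x‖ ^ 2 * Real.exp ‖x‖ + ‖x‖ * (‖x‖ * Real.exp ‖x‖) := add_le_add h2 h4
    _ = _ := by ring

lemma continuous_primaryFactor : Continuous primaryFactor := by
  unfold primaryFactor; fun_prop

/-- Moving Σ t_i into the exponential leaves factors 1 + O(t_i²), which can be dominated uniformly.
-/
lemma tprod_primaryFactor {t : ℕ → ℝ} (h : Summable t) (u : ℂ) :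
    ∏' i, (1 + primaryFactor (t i * u)) =
      (∏' i, (1 + (t i : ℂ) * u)) * Complex.exp (-((∑' i, t i : ℝ) * u)) := by
  have h1 : HasSum (fun i => -((t i : ℂ) * u)) (-((∑' i, t i : ℝ) * u)) :=
    ((Complex.hasSum_ofReal.2 h.hasSum).mul_right u).neg
  have h2 := (multipliable_one_add_ofReal_mul h u).hasProd.mul h1.cexp
  rw [← h2.tprod_eq]
  refine tprod_congr fun i => ?_
  simp [primaryFactor]

lemma one_add_sum_le_prod (t : ℕ → ℝ) (h : ∀ i, 0 ≤ t i) (n : ℕ) :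
    1 + ∑ i ∈ Finset.range n, t i ≤ ∏ i ∈ Finset.range n, (1 + t i) := by
  induction n with
  | zero => simp
  | succ n ih =>
    rw [Finset.sum_range_succ, Finset.prod_range_succ]
    have h1 : 0 ≤ ∑ i ∈ Finset.range n, t i := Finset.sum_nonneg fun i _ => h i
    nlinarith [h n, mul_le_mul_of_nonneg_right ih (h n), mul_nonneg h1 (h n)]

lemma one_add_tsum_le_tprod {t : ℕ → ℝ} (h : ∀ i, 0 ≤ t i) (hs : Summable t) :
    1 + ∑' i, t i ≤ ∏' i, (1 + t i) :=
  le_of_tendsto_of_tendsto' (hs.hasSum.tendsto_sum_nat.const_add 1)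
    (Real.multipliable_one_add_of_summable hs).hasProd.tendsto_prod_nat (one_add_sum_le_prod t h)

lemma tprod_one_add_ofReal {t : ℕ → ℝ} (hs : Summable t) :
    ∏' i, (1 + (t i : ℂ)) = ((∏' i, (1 + t i) : ℝ) : ℂ) := by
  have := (Real.multipliable_one_add_of_summable hs).hasProd.map Complex.ofRealHom
    Complex.continuous_ofReal
  rw [← Complex.ofRealHom_eq_coe, ← this.tprod_eq]
  simp

/-- The functions with a normal form around `1` are closed under pointwise limits which do not
vanish at `1`. -/
lemma HasShiftedForm.of_tendsto {F : ℕ → ℂ → ℂ} {G : ℂ → ℂ} (hF : ∀ n, HasShiftedForm (F n))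
    (hlim : ∀ z, Tendsto (fun n => F n z) atTop (𝓝 (G z))) (hG : G 1 ≠ 0) : HasShiftedForm G := by
  choose K α t hα hanti h0 h1 hsum hF using hF
  have hK (n : ℕ) : F n 1 = K n := by simp [hF]
  -- The total α + Σ t_i is kept as one parameter: mass of t may escape to infinity in the limit,
  -- and then it reappears in the exponential rate.
  set s : ℕ → ℝ := fun n => α n + ∑' i, t n i with hs
  have hs0 (n : ℕ) : 0 ≤ s n := add_nonneg (hα n) (tsum_nonneg (h0 n))
  -- At z = 2, where z - 1 = 1, the exponential and the product together are at least (1 + α)(1 + Σ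
  -- t_i) ≥ s.
  have hsK (n : ℕ) : s n * ‖K n‖ ≤ ‖F n 2‖ := by
    have e1 : F n 2 = K n * ((Real.exp (α n) * ∏' i, (1 + t n i) : ℝ) : ℂ) := by
      rw [hF, show (2 : ℂ) - 1 = 1 by norm_num]
      simp only [mul_one]
      rw [tprod_one_add_ofReal (hsum n)]
      push_cast
      ring
    have e2 := one_add_tsum_le_tprod (h0 n) (hsum n)
    have e3 := Real.add_one_le_exp (α n)
    have e4 : 0 ≤ ∑' i, t n i := tsum_nonneg (h0 n)
    have e5 : s n ≤ Real.exp (α n) * ∏' i, (1 + t n i) := by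
      calc s n ≤ (α n + 1) * (1 + ∑' i, t n i) := by
            simp only [hs]; nlinarith [mul_nonneg (hα n) e4]
        _ ≤ _ := mul_le_mul e3 e2 (by linarith) (Real.exp_pos _).le
    rw [e1, norm_mul, mul_comm, Complex.norm_of_nonneg ((hs0 n).trans e5)]
    exact mul_le_mul_of_nonneg_left e5 (norm_nonneg _)
  have hGpos : 0 < ‖G 1‖ := norm_pos_iff.2 hG
  set B : ℝ := 2 * (‖G 2‖ + 1) / ‖G 1‖ with hB
  have hsB : ∀ᶠ n in atTop, s n ≤ B := by
    have e1 := (hlim 1).norm.eventually (lt_mem_nhds (half_lt_self hGpos))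
    have e2 := (hlim 2).norm.eventually (gt_mem_nhds (lt_add_one ‖G 2‖))
    filter_upwards [e1, e2] with n h1 h2
    rw [hK] at h1
    rw [hB, le_div_iff₀ hGpos]
    have := mul_le_mul_of_nonneg_left h1.le (hs0 n)
    linarith [hsK n]
  have hcpt : IsCompact (Icc (0 : ℝ) B ×ˢ Set.univ.pi fun _ : ℕ => Icc (0 : ℝ) 1) :=
    isCompact_Icc.prod (isCompact_univ_pi fun _ => isCompact_Icc)
  obtain ⟨⟨σ, τ⟩, hmem, φ, hφ, hconv⟩ := hcpt.tendsto_subseq' (x := fun n => (s n, t n))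
    (hsB.mono fun n hn => ⟨⟨hs0 n, hn⟩, fun i _ => ⟨h0 n i, h1 n i⟩⟩).frequently
  have hσ : Tendsto (fun n => s (φ n)) atTop (𝓝 σ) := (continuous_fst.tendsto _).comp hconv
  have hτ (i : ℕ) : Tendsto (fun n => t (φ n) i) atTop (𝓝 (τ i)) :=
    tendsto_pi_nhds.1 ((continuous_snd.tendsto _).comp hconv) i
  have hτ0 (i : ℕ) : 0 ≤ τ i := (hmem.2 i trivial).1
  have hle (n N : ℕ) : ∑ i ∈ Finset.range N, t n i ≤ s n :=
    ((hsum n).sum_le_tsum _ fun i _ => h0 n i).trans (le_add_of_nonneg_left (hα n))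
  have hτσ (N : ℕ) : ∑ i ∈ Finset.range N, τ i ≤ σ :=
    le_of_tendsto_of_tendsto' (tendsto_finsetSum _ fun i _ => hτ i) hσ fun n => hle _ _
  have hτs : Summable τ := summable_of_sum_range_le hτ0 hτσ
  have hτt : ∑' i, τ i ≤ σ := Real.tsum_le_of_sum_range_le hτ0 hτσ
  -- The rate σ - Σ τ_i is the escaped mass, nonnegative because every partial sum of τ is at most
  -- σ.
  refine ⟨G 1, σ - ∑' i, τ i, τ, sub_nonneg.2 hτt, fun i j hij =>
    le_of_tendsto_of_tendsto' (hτ j) (hτ i) fun n => hanti _ hij, hτ0,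
    fun i => (hmem.2 i trivial).2, hτs, fun z => ?_⟩
  set u := z - 1 with hu
  have hform {K' : ℂ} {α' : ℝ} {t' : ℕ → ℝ} (h : Summable t') :
      K' * Complex.exp (α' * u) * ∏' i, (1 + (t' i : ℂ) * u) =
      K' * Complex.exp ((α' + ∑' i, t' i : ℝ) * u) * ∏' i, (1 + primaryFactor (t' i * u)) := by
    rw [tprod_primaryFactor h]
    have : Complex.exp (α' * u) = Complex.exp ((α' + ∑' i, t' i : ℝ) * u) *
        Complex.exp (-((∑' i, t' i : ℝ) * u)) := by
      rw [← Complex.exp_add]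
      push_cast
      ring_nf
    rw [this]
    ring
  rw [hform hτs, sub_add_cancel]
  refine tendsto_nhds_unique ((hlim z).comp hφ.tendsto_atTop) ?_
  have hlim2 : Tendsto (fun n => ∏' i, (1 + primaryFactor (t (φ n) i * u))) atTop
      (𝓝 (∏' i, (1 + primaryFactor (τ i * u)))) := by
    refine tendsto_tprod_one_add_of_dominated_convergence
      (bound := fun i : ℕ => 2 * Real.exp ‖u‖ * (B * ‖u‖) ^ 2 * (1 / ((i : ℝ) + 1) ^ 2))
      (Summable.mul_left _ ?_) (fun i => ?_) ?_
    · have := (summable_nat_add_iff 1).2 (Real.summable_one_div_nat_pow.2 one_lt_two)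
      simpa using this
    · exact (continuous_primaryFactor.tendsto _).comp
        (((Complex.continuous_ofReal.tendsto _).comp (hτ i)).mul_const u)
    · filter_upwards [hφ.tendsto_atTop.eventually hsB] with n hn i
      refine (norm_primaryFactor_le _).trans ?_
      have e1 : ‖(t (φ n) i : ℂ) * u‖ = t (φ n) i * ‖u‖ := by
        rw [norm_mul, Complex.norm_of_nonneg (h0 _ _)]
      have e2 : t (φ n) i * ‖u‖ ≤ ‖u‖ := mul_le_of_le_one_left (norm_nonneg _) (h1 _ _)
      -- Monotonicity: the i + 1 terms up to t_i are each at least t_i and sum to at most B.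
      have e3 : t (φ n) i ≤ B / (i + 1) := by
        rw [le_div_iff₀ (by positivity)]
        refine le_trans ?_ ((hle (φ n) (i + 1)).trans hn)
        have := Finset.card_nsmul_le_sum (Finset.range (i + 1)) (t (φ n)) (t (φ n) i)
          fun j hj => hanti _ (Nat.lt_succ_iff.1 (Finset.mem_range.1 hj))
        simp only [Finset.card_range, nsmul_eq_mul] at this
        push_cast at this
        linarith
      have e4 : t (φ n) i * ‖u‖ ≤ B / (i + 1) * ‖u‖ :=
        mul_le_mul_of_nonneg_right e3 (norm_nonneg _)
      have e5 : 0 ≤ t (φ n) i * ‖u‖ := mul_nonneg (h0 _ _) (norm_nonneg _)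
      rw [e1]
      calc _ ≤ 2 * Real.exp ‖u‖ * (B / (i + 1) * ‖u‖) ^ 2 := by gcongr
        _ = _ := by field_simp
  have hlim3 := (((hlim 1).comp hφ.tendsto_atTop).mul
    ((Complex.continuous_exp.tendsto _).comp
      (((Complex.continuous_ofReal.tendsto _).comp hσ).mul_const u))).mul hlim2
  refine hlim3.congr fun n => ?_
  simp only [Function.comp_apply, hK, hs]
  rw [hF, ← hu, hform (hsum (φ n))]

/-- A factor with t = 1 is z, and there are finitely many since t is summable; for t < 1, 1 + t(z -
1) = (1 - t)(1 + tz/(1 - t)). -/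
lemma HasShiftedForm.exists_hasLaguerreForm {F : ℂ → ℂ} (hF : HasShiftedForm F)
    (hd : Differentiable ℂ F) : ∃ α, 0 ≤ α ∧ HasLaguerreForm α F := by
  obtain ⟨K, α, t, hα, hanti, h0, h1, hsum, hF⟩ := hF
  have hex : ∃ i, t i < 1 :=
    (hsum.tendsto_atTop_zero.eventually (gt_mem_nhds one_pos)).exists
  classical
  set l := Nat.find hex with hl
  have hl1 : t l < 1 := Nat.find_spec hex
  have hl2 (i : ℕ) (hi : i < l) : t i = 1 :=
    le_antisymm (h1 i) (not_lt.1 (Nat.find_min hex hi))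
  have hl3 (i : ℕ) : t (i + l) < 1 := (hanti (Nat.le_add_left l i)).trans_lt hl1
  have hsl : Summable fun i => t (i + l) := (summable_nat_add_iff l).2 hsum
  have hβ0 (i : ℕ) : 0 ≤ t (i + l) / (1 - t (i + l)) :=
    div_nonneg (h0 _) (by linarith [hl3 i])
  have hβs : Summable fun i => t (i + l) / (1 - t (i + l)) := by
    refine Summable.of_nonneg_of_le hβ0 (fun i => ?_) (hsl.mul_right (1 / (1 - t l)))
    rw [mul_one_div]
    have := hanti (Nat.le_add_left l i)
    have := h0 (i + l)
    gcongr
  refine ⟨α, hα, hd, K * Complex.exp (-α) * ∏' i, (1 + ((-t (i + l) : ℝ) : ℂ) * 1), l,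
    fun i => t (i + l) / (1 - t (i + l)), fun i j hij => ?_, hβ0, hβs, fun z => ?_⟩
  · have e1 := hanti (Nat.add_le_add_right hij l)
    have e2 := hl3 i
    have e3 := h0 (j + l)
    dsimp only
    rw [div_le_div_iff₀ (by linarith) (by linarith)]
    nlinarith
  · have e0 := Multipliable.prod_mul_tprod_nat_mul' (k := l)
      (f := fun i => 1 + (t i : ℂ) * (z - 1)) (multipliable_one_add_ofReal_mul hsl (z - 1))
    rw [hF, ← e0]
    have e1 : ∏ i ∈ Finset.range l, (1 + (t i : ℂ) * (z - 1)) = z ^ l := by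
      rw [Finset.prod_congr rfl fun i hi => show 1 + (t i : ℂ) * (z - 1) = z by
        rw [hl2 i (Finset.mem_range.1 hi)]; push_cast; ring]
      simp
    have e2 : ∏' i, (1 + (t (i + l) : ℂ) * (z - 1)) =
        (∏' i, (1 + ((-t (i + l) : ℝ) : ℂ) * 1)) *
          ∏' i, (1 + ((t (i + l) / (1 - t (i + l)) : ℝ) : ℂ) * z) := by
      rw [← Multipliable.tprod_mul (multipliable_one_add_ofReal_mul hsl.neg 1)
        (multipliable_one_add_ofReal_mul hβs z)]
      refine tprod_congr fun i => ?_
      have : (1 - (t (i + l) : ℂ)) ≠ 0 := by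
        exact_mod_cast (sub_pos.2 (hl3 i)).ne'
      push_cast
      field_simp
      ring
    have e3 : Complex.exp (α * (z - 1)) = Complex.exp (-α) * Complex.exp (α * z) := by
      rw [← Complex.exp_add]; ring_nf
    rw [e1, e2, e3]
    ring
end

/-! ### Taylor coefficients, the double series and the change of type -/

noncomputable section
open Filter Topology

lemma differentiable_and_iteratedDeriv_of_hasSum {g : ℕ → ℂ} {G : ℂ → ℂ}
    (hG : ∀ z, HasSum (fun i => g i * z ^ i) (G z)) :
    Differentiable ℂ G ∧ ∀ i : ℕ, iteratedDeriv i G 0 = i.factorial * g i := by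
  have h : HasFPowerSeriesOnBall G (FormalMultilinearSeries.ofScalars ℂ g) 0 ⊤ := by
    refine ⟨?_, ENNReal.zero_lt_top, fun {y} _ => ?_⟩
    · rw [FormalMultilinearSeries.radius_eq_top_of_summable_norm]
      intro r
      refine (hG (r : ℝ)).summable.norm.congr fun n => ?_
      rw [FormalMultilinearSeries.ofScalars_norm]
      simp
    · simpa [FormalMultilinearSeries.ofScalars_apply_eq, mul_comm] using hG y
  constructor
  · have := h.differentiableOn
    rwa [Metric.eball_top, differentiableOn_univ] at this
  · intro i
    rw [iteratedDeriv_eq_iteratedFDeriv, ← h.factorial_smul 1 i]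
    simp

lemma mem_entireB_of_hasSum {g : ℕ → ℂ} {G : ℂ → ℂ} {K e b : ℝ}
    (hG : ∀ z, HasSum (fun i => g i * z ^ i) (G z)) (he : 0 ≤ e) (heb : e ≤ b) (hb : 0 < b)
    (hg : ∀ i, ‖g i‖ ≤ K * (e ^ i / i.factorial)) : G ∈ entireB b := by
  obtain ⟨h1, h2⟩ := differentiable_and_iteratedDeriv_of_hasSum hG
  have hK : 0 ≤ K := by simpa using (norm_nonneg _).trans (hg 0)
  refine ⟨h1, K, ?_⟩
  rintro _ ⟨k, rfl⟩
  dsimp only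
  rw [h2, norm_mul, Complex.norm_natCast, inv_mul_le_iff₀ (by positivity)]
  calc (k.factorial : ℝ) * ‖g k‖ ≤ k.factorial * (K * (e ^ k / k.factorial)) := by
        gcongr; exact hg k
    _ = e ^ k * K := by field_simp
    _ ≤ b ^ k * K := by gcongr

lemma hasSum_iteratedDeriv {f : ℂ → ℂ} (hf : Differentiable ℂ f) (z : ℂ) :
    HasSum (fun m : ℕ => iteratedDeriv m f 0 / (m.factorial : ℂ) * z ^ m) (f z) := by
  refine (Complex.hasSum_taylorSeries_of_entire hf 0 z).congr_fun fun m => ?_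
  simp only [sub_zero, smul_eq_mul]
  ring

lemma norm_iteratedDeriv_le_of_mem_entireB {f : ℂ → ℂ} {b : ℝ} (hb : 0 < b) (hf : f ∈ entireB b) :
    ∃ K, ∀ m : ℕ, ‖iteratedDeriv m f 0 / (m.factorial : ℂ)‖ ≤ K * (b ^ m / m.factorial) := by
  obtain ⟨-, K, hK⟩ := hf
  refine ⟨K, fun m => ?_⟩
  have := hK ⟨m, rfl⟩
  dsimp only at this
  rw [inv_mul_le_iff₀ (by positivity)] at this
  rw [norm_div, Complex.norm_natCast, ← mul_div_assoc]
  gcongr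
  linarith

lemma norm_le_exp_of_hasSum {c : ℕ → ℂ} {f : ℂ → ℂ} {K d : ℝ}
    (hc : ∀ m, ‖c m‖ ≤ K * (d ^ m / m.factorial)) (hf : ∀ z, HasSum (fun m => c m * z ^ m) (f z))
    (z : ℂ) : ‖f z‖ ≤ K * Real.exp (d * ‖z‖) := by
  have h1 : HasSum (fun m : ℕ => K * ((d * ‖z‖) ^ m / m.factorial)) (K * Real.exp (d * ‖z‖)) := by
    have := (NormedSpace.expSeries_div_hasSum_exp (𝔸 := ℝ) (d * ‖z‖)).mul_left K
    rwa [← Real.exp_eq_exp_ℝ] at this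
  rw [← (hf z).tsum_eq]
  refine tsum_of_norm_bounded h1 fun m => ?_
  rw [norm_mul, norm_pow]
  calc ‖c m‖ * ‖z‖ ^ m ≤ K * (d ^ m / m.factorial) * ‖z‖ ^ m := by gcongr; exact hc m
    _ = _ := by rw [mul_pow]; ring

lemma expDeltaIntegrand_scale {a : ℝ} (θ : ℝ) (f : ℂ → ℂ) (z : ℂ) :
    expDeltaIntegrand a θ f z = expDeltaIntegrand 1 θ (fun w => f (a * w)) (z / a) := by
  ext s
  simp [expDeltaIntegrand, mul_div_assoc]

lemma expDelta_scale {a : ℝ} (θ : ℝ) (f : ℂ → ℂ) (z : ℂ) :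
    expDelta a θ f z = expDelta 1 θ (fun w => f (a * w)) (z / a) := by
  simp [expDelta, expDeltaIntegrand_scale (a := a), neg_div]

lemma deltaOp_const_mul_pow (θ : ℝ) (A : ℂ) (n : ℕ) :
    deltaOp θ (fun w => A * w ^ (n + 1)) = fun w => (A * ((n + 1) * (θ + n))) * w ^ n := by
  have h1 : deriv (fun w : ℂ => A * w ^ (n + 1)) = fun w => (A * (n + 1)) * w ^ n := by
    ext w; simp [mul_assoc]
  ext w
  rw [deltaOp, h1]
  rcases n with - | n
  · simp; ring
  · simp; ring

lemma deltaOp_const (θ : ℝ) (A : ℂ) : deltaOp θ (fun _ => A) = fun _ => 0 := by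
  ext w
  simp [deltaOp]

lemma deltaOp_iterate_zero (θ : ℝ) (k : ℕ) : (deltaOp θ)^[k] (fun _ => 0) = fun _ => 0 := by
  induction k with
  | zero => rfl
  | succ k ih => rw [Function.iterate_succ_apply, deltaOp_const, ih]

lemma deltaOp_iterate_pow (θ : ℝ) (j k : ℕ) (A : ℂ) :
    (deltaOp θ)^[k] (fun w => A * w ^ (j + k)) = fun w =>
      A * (((j + k).factorial / j.factorial * rising (θ + j) k : ℝ) : ℂ) * w ^ j := by
  induction k generalizing A with
  | zero =>
    have : (j.factorial : ℂ) ≠ 0 := by exact_mod_cast j.factorial_ne_zero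
    simp [this]
  | succ k ih =>
    rw [Function.iterate_succ_apply, ← add_assoc, deltaOp_const_mul_pow, ih]
    ext w
    rw [rising_succ, Nat.factorial_succ]
    push_cast
    ring

lemma deltaOp_iterate_pow_eq_zero (θ : ℝ) {m k : ℕ} (h : m < k) :
    (deltaOp θ)^[k] (fun w => w ^ m) = fun _ => 0 := by
  obtain ⟨i, rfl⟩ := Nat.exists_eq_add_of_lt h
  have := deltaOp_iterate_pow θ 0 m 1
  simp only [zero_add, one_mul, pow_zero, mul_one] at this
  rw [show m + i + 1 = i + (m + 1) by ring, Function.iterate_add_apply,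
    Function.iterate_succ_apply', this, deltaOp_const, deltaOp_iterate_zero]

lemma deltaSeriesTerm_exp {a : ℝ} (ha : 0 < a) (θ : ℝ) (f : ℂ → ℂ) (z : ℂ) (j k : ℕ) :
    deltaSeriesTerm θ (fun w => Complex.exp (a * w)) f z (k, j + k) =
      iteratedDeriv (j + k) f 0 / ((j + k).factorial : ℂ) * (a : ℂ) ^ (j + k) *
        (lagCoeff θ (j + k) j : ℂ) * (z / a) ^ j := by
  have h1 := deltaOp_iterate_pow θ j k 1
  simp only [one_mul] at h1
  have ha' : (a : ℂ) ≠ 0 := by exact_mod_cast ha.ne'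
  have h2 : ((j + k).choose j : ℂ) = (j + k).factorial / (j.factorial * k.factorial) := by
    rw [Nat.choose_symm_add, Nat.add_choose,
      Nat.cast_div (Nat.factorial_mul_factorial_dvd_factorial_add j k)
      (by exact_mod_cast (by positivity : j.factorial * k.factorial ≠ 0))]
    push_cast; rfl
  rw [deltaSeriesTerm, h1]
  simp only [lagCoeff, Nat.add_sub_cancel_left, iteratedDeriv_cexp_const_mul, mul_zero,
    Complex.exp_zero, mul_one]
  push_cast
  rw [h2, div_pow, pow_add]
  field_simp

lemma deltaSeriesTerm_eq_zero (θ : ℝ) (φ f : ℂ → ℂ) (z : ℂ) {k m : ℕ} (h : m < k) :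
    deltaSeriesTerm θ φ f z (k, m) = 0 := by
  simp [deltaSeriesTerm, deltaOp_iterate_pow_eq_zero θ h]

section Series

variable {θ K d : ℝ} {c : ℕ → ℂ} {f : ℂ → ℂ} (hθ : 0 ≤ θ) (hd : 0 ≤ d) (hd1 : d < 1)
  (hc : ∀ m, ‖c m‖ ≤ K * (d ^ m / m.factorial)) (hf : ∀ z, HasSum (fun m => c m * z ^ m) (f z))

-- The coefficient of z^i is dominated by a binomial series of exponent θ + i; its sum (1-d)^{-θ-i}
-- turns d into d/(1-d).
include hθ hd hd1 hc hf in
lemma exists_hasSum_expDelta : ∃ g : ℕ → ℂ,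
    (∀ z, HasSum (fun i => g i * z ^ i) (expDelta 1 θ f z)) ∧
    ∀ i, ‖g i‖ ≤ K / (1 - d) ^ θ * ((d / (1 - d)) ^ i / i.factorial) := by
  have h1 : 0 < 1 - d := by linarith
  have hbound (i : ℕ) : HasSum (fun k : ℕ => K * (d ^ i / i.factorial) *
      (rising (θ + i) k * d ^ k / k.factorial))
      (K / (1 - d) ^ θ * ((d / (1 - d)) ^ i / i.factorial)) := by
    have h2 := (hasSum_rising (θ + i) (x := d) (by rwa [abs_of_nonneg hd])).mul_left
      (K * (d ^ i / i.factorial))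
    have h3 : K / (1 - d) ^ θ * ((d / (1 - d)) ^ i / i.factorial) =
        K * (d ^ i / i.factorial) * (1 / (1 - d) ^ (θ + i)) := by
      rw [Real.rpow_add h1, Real.rpow_natCast, div_pow]
      field_simp
    rwa [h3]
  have hterm (i k : ℕ) : ‖c (i + k) * (lagCoeff θ (i + k) i : ℂ)‖ ≤
      K * (d ^ i / i.factorial) * (rising (θ + i) k * d ^ k / k.factorial) := by
    have h2 := lagCoeff_nonneg hθ (i + k) i
    rw [norm_mul, Complex.norm_of_nonneg h2]
    calc ‖c (i + k)‖ * lagCoeff θ (i + k) i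
        ≤ (K * (d ^ (i + k) / (i + k).factorial)) * lagCoeff θ (i + k) i := by
          gcongr; exact hc _
      _ = _ := by
          have h3 : ((i + k).factorial : ℝ) = (i + k).choose i * i.factorial * k.factorial := by
            rw [Nat.choose_symm_add]
            exact_mod_cast (Nat.add_choose_mul_factorial_mul_factorial i k).symm
          have h4 : (0 : ℝ) < (i + k).choose i := by
            exact_mod_cast Nat.choose_pos (Nat.le_add_right i k)
          simp only [lagCoeff, h3, Nat.add_sub_cancel_left, pow_add]
          field_simp
  have hs (i : ℕ) : Summable fun k => c (i + k) * (lagCoeff θ (i + k) i : ℂ) :=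
    (hbound i).summable.of_norm_bounded (hterm i)
  refine ⟨fun i => ∑' k, c (i + k) * (lagCoeff θ (i + k) i : ℂ), fun z => ?_, fun i =>
    tsum_of_norm_bounded (hbound i) (hterm i)⟩
  have h4 (i : ℕ) : HasSum (fun k => c (i + k) * (lagCoeff θ (i + k) i : ℂ) * z ^ i)
      ((∑' k, c (i + k) * (lagCoeff θ (i + k) i : ℂ)) * z ^ i) := (hs i).hasSum.mul_right (z ^ i)
  exact HasSum.prod_fiberwise (hasSum_lagCoeff hθ hd hd1 hc hf z) h4

end Series

section Entire

variable {a θ b : ℝ} {f : ℂ → ℂ} (ha : 0 < a) (hθ : 0 ≤ θ) (hb : 0 ≤ b) (hab : b < 1 / a)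
  (hf : f ∈ entireA b)

include ha hb in
lemma hasSum_scaled_of_mem_entireA {d : ℝ} (hbd : b < d) (hf : f ∈ entireB d) :
    ∃ K, (∀ m : ℕ, ‖iteratedDeriv m f 0 / (m.factorial : ℂ) * (a : ℂ) ^ m‖ ≤
      K * ((a * d) ^ m / m.factorial)) ∧ ∀ z : ℂ, HasSum (fun m : ℕ =>
        iteratedDeriv m f 0 / (m.factorial : ℂ) * (a : ℂ) ^ m * z ^ m) (f (a * z)) := by
  obtain ⟨K, hK⟩ := norm_iteratedDeriv_le_of_mem_entireB (hb.trans_lt hbd) hf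
  refine ⟨K, fun m => ?_, fun z => ?_⟩
  · rw [norm_mul, norm_pow, Complex.norm_of_nonneg ha.le]
    calc _ ≤ K * (d ^ m / m.factorial) * a ^ m := by gcongr; exact hK m
      _ = _ := by rw [mul_pow]; ring
  · refine (hasSum_iteratedDeriv hf.1 (a * z)).congr_fun fun m => ?_
    rw [mul_pow]; ring

include ha hθ hb hab hf in
lemma integrableOn_and_hasSum_expDelta_of_mem_entireA (z : ℂ) :
    IntegrableOn (expDeltaIntegrand a θ f z) (Ioi 0) ∧
    HasSum (deltaSeriesTerm θ (fun w : ℂ => Complex.exp ((a : ℂ) * w)) f z)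
        (expDelta a θ f z) := by
  obtain ⟨d, hbd, hd⟩ := exists_between hab
  have hd0 : 0 < d := hb.trans_lt hbd
  have had : a * d < 1 := by rwa [lt_div_iff₀ ha, mul_comm] at hd
  obtain ⟨K, hc, hs⟩ := hasSum_scaled_of_mem_entireA ha hb hbd (hf d hbd)
  constructor
  · rw [expDeltaIntegrand_scale]
    exact (integrable_and_hasSum_expDelta hθ (by positivity) had hc hs _).1
  · rw [expDelta_scale]
    have h1 := hasSum_lagCoeff hθ (by positivity) had hc hs (z / a)
    have hinj : Function.Injective fun p : ℕ × ℕ => (p.2, p.1 + p.2) := by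
      rintro ⟨a, b⟩ ⟨a', b'⟩ h
      simp only [Prod.mk.injEq] at h ⊢
      omega
    refine (hinj.hasSum_iff ?_).1 (h1.congr_fun fun p => ?_)
    · rintro ⟨k, m⟩ hq
      refine deltaSeriesTerm_eq_zero _ _ _ _ ?_
      by_contra hlt
      exact hq ⟨(m - k, k), by simp at hlt ⊢; omega⟩
    · exact deltaSeriesTerm_exp ha θ f z p.1 p.2

include ha hθ hb hab hf in
lemma expDelta_mem_entireA : expDelta a θ f ∈ entireA (b / (1 - a * b)) := by
  intro b' hb'
  have hab1 : 0 < 1 - a * b := by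
    rw [lt_div_iff₀ ha] at hab; linarith
  have hb'0 : 0 < b' := lt_of_le_of_lt (by positivity) hb'
  rw [div_lt_iff₀ hab1] at hb'
  have hpos : 0 < 1 + a * b' := by positivity
  -- d = b'/(1 + ab') inverts d ↦ d/(1 - ad), so b < d is equivalent to b/(1 - ab) < b'.
  obtain ⟨K, hc, hs⟩ := hasSum_scaled_of_mem_entireA ha hb (d := b' / (1 + a * b'))
    (by rw [lt_div_iff₀ hpos]; linarith) (hf _ (by rw [lt_div_iff₀ hpos]; linarith))
  have h1 : 1 - a * (b' / (1 + a * b')) = 1 / (1 + a * b') := by field_simp; ring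
  obtain ⟨g, hg, hgb⟩ := exists_hasSum_expDelta hθ (by positivity)
    (by rw [← sub_pos, h1]; positivity) hc hs
  refine mem_entireB_of_hasSum (K := K / (1 - a * (b' / (1 + a * b'))) ^ θ)
    (g := fun i => g i * ((a : ℂ) ^ i)⁻¹) (fun z => ?_) hb'0.le le_rfl
    hb'0 (fun i => ?_)
  · rw [expDelta_scale]
    refine (hg (z / a)).congr_fun fun i => ?_
    rw [div_pow]; ring
  · have h2 : a * (b' / (1 + a * b')) / (1 - a * (b' / (1 + a * b'))) = a * b' := by
      rw [h1]; field_simp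
    have h3 := hgb i
    rw [h2] at h3
    rw [norm_mul, norm_inv, norm_pow, Complex.norm_of_nonneg ha.le]
    calc _ ≤ _ * ((a * b') ^ i / i.factorial) * (a ^ i)⁻¹ :=
          mul_le_mul_of_nonneg_right h3 (by positivity)
      _ = _ := by rw [mul_pow]; field_simp

end Entire
end

/-! ### Genus zero -/

noncomputable section
open Filter Topology

/-- The Laguerre entire function `z^l ∏ (1 + β_j z)` of genus zero. -/
def genusZero (l : ℕ) (β : ℕ → ℝ) (z : ℂ) : ℂ := z ^ l * ∏' j, (1 + (β j : ℂ) * z)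

/-- The truncations of `genusZero l β`. -/
def truncPoly (l : ℕ) (β : ℕ → ℝ) (n : ℕ) : Polynomial ℝ :=
  Polynomial.X ^ l * ∏ j ∈ Finset.range n, (1 + Polynomial.C (β j) * Polynomial.X)

lemma aeval_truncPoly (l : ℕ) (β : ℕ → ℝ) (n : ℕ) (z : ℂ) :
    Polynomial.aeval z (truncPoly l β n) =
      z ^ l * ∏ j ∈ Finset.range n, (1 + (β j : ℂ) * z) := by
  simp [truncPoly, map_prod]

lemma coeff_mul_nonneg_of_nonneg {p q : Polynomial ℝ} (hp : ∀ m, 0 ≤ p.coeff m)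
    (hq : ∀ m, 0 ≤ q.coeff m) (m : ℕ) : 0 ≤ (p * q).coeff m := by
  rw [Polynomial.coeff_mul]
  exact Finset.sum_nonneg fun x _ => mul_nonneg (hp _) (hq _)

lemma coeff_truncPoly_nonneg (l : ℕ) {β : ℕ → ℝ} (hβ : ∀ j, 0 ≤ β j) (n m : ℕ) :
    0 ≤ (truncPoly l β n).coeff m := by
  induction n generalizing m with
  | zero =>
    simp only [truncPoly, Finset.range_zero, Finset.prod_empty, mul_one, Polynomial.coeff_X_pow]
    split_ifs <;> norm_num
  | succ n ih =>
    rw [truncPoly, Finset.prod_range_succ, ← mul_assoc]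
    refine coeff_mul_nonneg_of_nonneg ih (fun k => ?_) m
    rw [Polynomial.coeff_add, Polynomial.coeff_C_mul, Polynomial.coeff_one, Polynomial.coeff_X]
    have := hβ n
    split_ifs <;> simp [this]; linarith

/-- The leading coefficient of each `lagPoly` is 1 and the others are nonnegative. This keeps the
values at 1 away from 0, as `HasShiftedForm.of_tendsto` requires. -/
lemma eval_one_le_expPoly {θ : ℝ} (hθ : 0 ≤ θ) {p : Polynomial ℝ} (hp : ∀ m, 0 ≤ p.coeff m) :
    p.eval 1 ≤ (expPoly θ p).eval 1 := by
  rw [expPoly_apply, Polynomial.eval_finsetSum, Polynomial.eval_eq_sum_range]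
  refine Finset.sum_le_sum fun m _ => ?_
  rw [Polynomial.eval_smul, smul_eq_mul, one_pow]
  refine mul_le_mul_of_nonneg_left ?_ (hp m)
  rw [lagPoly, Polynomial.eval_finsetSum]
  simp only [Polynomial.eval_monomial, one_pow, mul_one]
  calc (1 : ℝ) = lagCoeff θ m m := by simp [lagCoeff]
    _ ≤ _ := Finset.single_le_sum (fun i _ => lagCoeff_nonneg hθ m i) (by simp)

lemma one_le_eval_expPoly_truncPoly {θ : ℝ} (hθ : 0 ≤ θ) (l : ℕ) {β : ℕ → ℝ} (hβ : ∀ j, 0 ≤ β j)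
    (n : ℕ) : 1 ≤ (expPoly θ (truncPoly l β n)).eval 1 := by
  refine le_trans ?_ (eval_one_le_expPoly hθ (coeff_truncPoly_nonneg l hβ n))
  simp only [truncPoly, Polynomial.eval_mul, Polynomial.eval_pow, Polynomial.eval_X, one_pow,
    one_mul, Polynomial.eval_prod, Polynomial.eval_add, Polynomial.eval_one, Polynomial.eval_C,
    mul_one]
  exact (le_add_of_nonneg_right (Finset.sum_nonneg fun i _ => hβ i)).trans
    (one_add_sum_le_prod β hβ n)

lemma aeval_one_eq (p : Polynomial ℝ) : Polynomial.aeval (1 : ℂ) p = (p.eval 1 : ℝ) := by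
  have := Polynomial.aeval_algebraMap_apply ℂ (1 : ℝ) p
  simpa using this

lemma hasShiftedForm_expPoly_truncPoly {θ : ℝ} (hθ : 0 ≤ θ) (l : ℕ) {β : ℕ → ℝ}
    (hβ : ∀ j, 0 ≤ β j) (n : ℕ) :
    HasShiftedForm fun z => Polynomial.aeval z (expPoly θ (truncPoly l β n)) := by
  have hpos {θ' : ℝ} (h : 0 < θ') :
      HasShiftedForm fun z => Polynomial.aeval z (expPoly θ' (truncPoly l β n)) := by
    obtain ⟨N, hN⟩ := exists_hasNegRoots_expPoly h l n β hβ
    exact hN.hasShiftedForm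
  rcases hθ.eq_or_lt with rfl | h
  · refine HasShiftedForm.of_tendsto
      (F := fun k z => Polynomial.aeval z (expPoly (1 / ((k : ℝ) + 1)) (truncPoly l β n)))
      (fun k => hpos (by positivity)) (fun z => ?_) ?_
    · exact ((continuous_aeval_expPoly _ z).tendsto 0).comp tendsto_one_div_add_atTop_nhds_zero_nat
    · rw [aeval_one_eq]
      have := one_le_eval_expPoly_truncPoly le_rfl l hβ n
      exact_mod_cast (show (0 : ℝ) < _ by linarith).ne'
  · exact hpos h

lemma tendsto_truncPoly (l : ℕ) {β : ℕ → ℝ} (hs : Summable β) (z : ℂ) :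
    Tendsto (fun n => Polynomial.aeval z (truncPoly l β n)) atTop (𝓝 (genusZero l β z)) := by
  simp only [aeval_truncPoly]
  exact (multipliable_one_add_ofReal_mul hs z).hasProd.tendsto_prod_nat.const_mul _

/-- On the positive axis every factor is at least 1, so the truncations increase in norm and the
limit itself is the dominating function. -/
lemma norm_truncPoly_le (l : ℕ) {β : ℕ → ℝ} (hβ : ∀ j, 0 ≤ β j) (hs : Summable β) {s : ℝ}
    (h0 : 0 ≤ s) (n : ℕ) :
    ‖Polynomial.aeval (s : ℂ) (truncPoly l β n)‖ ≤ ‖genusZero l β s‖ := by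
  refine Monotone.ge_of_tendsto (f := fun n => ‖Polynomial.aeval (s : ℂ) (truncPoly l β n)‖)
    (monotone_nat_of_le_succ fun n => ?_) (tendsto_truncPoly l hs s).norm n
  rw [aeval_truncPoly, aeval_truncPoly, Finset.prod_range_succ, ← mul_assoc, norm_mul _ (1 + _)]
  refine le_mul_of_one_le_right (norm_nonneg _) ?_
  have : (1 + (β n : ℂ) * s) = ((1 + β n * s : ℝ) : ℂ) := by push_cast; rfl
  have h2 : 0 ≤ β n * s := mul_nonneg (hβ n) h0
  rw [this, Complex.norm_of_nonneg (by linarith)]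
  linarith

lemma one_add_mul_le_exp {b ε x : ℝ} (hb : 0 ≤ b) (hε : 0 < ε) (hx : 0 ≤ x) :
    1 + b * x ≤ (1 + b / ε) * Real.exp (ε * x) := by
  have h1 := Real.add_one_le_exp (ε * x)
  have h2 : 0 ≤ b / ε := by positivity
  have h3 : 0 ≤ ε * x := by positivity
  calc 1 + b * x = 1 + (b / ε) * (ε * x) := by field_simp
    _ ≤ (1 + b / ε) * (ε * x + 1) := by nlinarith
    _ ≤ _ := by gcongr

lemma exists_norm_truncPoly_le (l : ℕ) {β : ℕ → ℝ} (hβ : ∀ j, 0 ≤ β j) (n : ℕ) {ε : ℝ}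
    (hε : 0 < ε) :
    ∃ K, 0 ≤ K ∧ ∀ z : ℂ, ‖Polynomial.aeval z (truncPoly l β n)‖ ≤ K * Real.exp (ε * ‖z‖) := by
  induction n generalizing ε with
  | zero =>
    induction l generalizing ε with
    | zero =>
      refine ⟨1, zero_le_one, fun z => ?_⟩
      simpa [aeval_truncPoly] using (by positivity : 0 ≤ ε * ‖z‖)
    | succ l ih =>
      obtain ⟨K, hK, h⟩ := ih (half_pos hε)
      refine ⟨(1 + 1 / (ε / 2)) * K, by positivity, fun z => ?_⟩
      have h1 := one_add_mul_le_exp zero_le_one (half_pos hε) (norm_nonneg z)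
      have h2 := h z
      simp only [aeval_truncPoly, Finset.range_zero, Finset.prod_empty, mul_one] at h2 ⊢
      rw [pow_succ', norm_mul]
      calc ‖z‖ * ‖z ^ l‖ ≤ ((1 + 1 / (ε / 2)) * Real.exp (ε / 2 * ‖z‖)) *
            (K * Real.exp (ε / 2 * ‖z‖)) := by
            refine mul_le_mul (by linarith) h2 (norm_nonneg _) (by positivity)
        _ = (1 + 1 / (ε / 2)) * K * (Real.exp (ε / 2 * ‖z‖) * Real.exp (ε / 2 * ‖z‖)) := by ring
        _ = _ := by rw [← Real.exp_add]; ring_nf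
  | succ n ih =>
    obtain ⟨K, hK, h⟩ := ih (half_pos hε)
    have hb := hβ n
    refine ⟨K * (1 + β n / (ε / 2)), by positivity, fun z => ?_⟩
    have h1 := one_add_mul_le_exp hb (half_pos hε) (norm_nonneg z)
    have h2 := h z
    rw [aeval_truncPoly] at h2 ⊢
    rw [Finset.prod_range_succ, ← mul_assoc, norm_mul _ (1 + _)]
    have h3 : ‖1 + (β n : ℂ) * z‖ ≤ 1 + β n * ‖z‖ := by
      refine (norm_add_le _ _).trans ?_
      rw [norm_one, norm_mul, Complex.norm_of_nonneg hb]
    calc _ ≤ (K * Real.exp (ε / 2 * ‖z‖)) *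
          ((1 + β n / (ε / 2)) * Real.exp (ε / 2 * ‖z‖)) :=
          mul_le_mul h2 (h3.trans h1) (norm_nonneg _) (by positivity)
      _ = K * (1 + β n / (ε / 2)) * (Real.exp (ε / 2 * ‖z‖) * Real.exp (ε / 2 * ‖z‖)) := by ring
      _ = _ := by rw [← Real.exp_add]; ring_nf

lemma norm_tprod_le_exp {t : ℕ → ℝ} (h : ∀ j, 0 ≤ t j) (hs : Summable t) (z : ℂ) :
    ‖∏' j, (1 + (t j : ℂ) * z)‖ ≤ Real.exp ((∑' j, t j) * ‖z‖) := by
  refine le_of_tendsto' (multipliable_one_add_ofReal_mul hs z).hasProd.tendsto_prod_nat.norm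
    fun n => ?_
  rw [norm_prod]
  calc ∏ j ∈ Finset.range n, ‖1 + (t j : ℂ) * z‖
      ≤ ∏ j ∈ Finset.range n, Real.exp (t j * ‖z‖) := by
        refine Finset.prod_le_prod (fun _ _ => norm_nonneg _) fun j _ => ?_
        refine (norm_add_le _ _).trans ?_
        rw [norm_one, norm_mul, Complex.norm_of_nonneg (h j), add_comm]
        exact Real.add_one_le_exp _
    _ = Real.exp ((∑ j ∈ Finset.range n, t j) * ‖z‖) := by rw [← Real.exp_sum, Finset.sum_mul]
    _ ≤ _ := by
        gcongr
        exact hs.sum_le_tsum _ fun j _ => h j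

/-- Laguerre entire functions of genus zero are of minimal exponential type. -/
lemma exists_norm_genusZero_le (l : ℕ) {β : ℕ → ℝ} (hβ : ∀ j, 0 ≤ β j) (hs : Summable β) {ε : ℝ}
    (hε : 0 < ε) : ∃ K, 0 ≤ K ∧ ∀ z : ℂ, ‖genusZero l β z‖ ≤ K * Real.exp (ε * ‖z‖) := by
  -- The tail of the product has type at most its sum of β, here less than ε/2; the head is a
  -- polynomial.
  obtain ⟨N, hN⟩ := ((tendsto_sum_nat_add β).eventually (gt_mem_nhds (half_pos hε))).exists
  obtain ⟨K, hK, h⟩ := exists_norm_truncPoly_le l hβ N (half_pos hε)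
  have hsN := (summable_nat_add_iff N).2 hs
  refine ⟨K, hK, fun z => ?_⟩
  have e0 := Multipliable.prod_mul_tprod_nat_mul' (k := N)
    (f := fun j => 1 + (β j : ℂ) * z) (multipliable_one_add_ofReal_mul hsN z)
  rw [genusZero, ← e0, ← mul_assoc, ← aeval_truncPoly, norm_mul]
  calc _ ≤ (K * Real.exp (ε / 2 * ‖z‖)) * Real.exp (ε / 2 * ‖z‖) := by
        refine mul_le_mul (h z) ((norm_tprod_le_exp (fun j => hβ _) hsN z).trans ?_)
          (norm_nonneg _) (by positivity)
        gcongr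
    _ = K * (Real.exp (ε / 2 * ‖z‖) * Real.exp (ε / 2 * ‖z‖)) := by ring
    _ = _ := by rw [← Real.exp_add]; ring_nf

lemma exists_coeff_bound_genusZero {l : ℕ} {β : ℕ → ℝ} (hβ : ∀ j, 0 ≤ β j) (hs : Summable β)
    (hdiff : Differentiable ℂ (genusZero l β)) {d : ℝ} (hd : 0 < d) :
    ∃ K, ∀ m : ℕ, ‖iteratedDeriv m (genusZero l β) 0 / (m.factorial : ℂ)‖ ≤
      K * (d ^ m / m.factorial) := by
  -- Cauchy's estimate on the radius m/ε gives m! (eε/m)^m ≤ (eε)^m, which is d^m for this ε.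
  set ε := d / Real.exp 1 with hε
  have hε0 : 0 < ε := by positivity
  obtain ⟨K, hK, h⟩ := exists_norm_genusZero_le l hβ hs hε0
  refine ⟨K, fun m => ?_⟩
  rw [norm_div, Complex.norm_natCast, ← mul_div_assoc]
  gcongr
  rcases Nat.eq_zero_or_pos m with rfl | hm
  · simpa using h 0
  have hm' : (0 : ℝ) < m := by exact_mod_cast hm
  have h1 := Complex.norm_iteratedDeriv_le_of_forall_mem_sphere_norm_le (c := 0) (R := m / ε)
    (C := K * Real.exp m) m (by positivity) hdiff.diffContOnCl (fun z hz => by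
      have hz' : ‖z‖ = m / ε := by simpa using hz
      have := h z
      rwa [hz', mul_div_cancel₀ _ hε0.ne'] at this)
  refine h1.trans ?_
  have h2 : (m.factorial : ℝ) ≤ (m : ℝ) ^ m := by exact_mod_cast m.factorial_le_pow
  have h3 : Real.exp m = Real.exp 1 ^ m := by rw [← Real.exp_nat_mul, mul_one]
  rw [div_le_iff₀ (by positivity), h3]
  calc (m.factorial : ℝ) * (K * Real.exp 1 ^ m) ≤ (m : ℝ) ^ m * (K * Real.exp 1 ^ m) := by gcongr
    _ = K * d ^ m * (m / ε) ^ m := by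
      have : d * (m / ε) = m * Real.exp 1 := by rw [hε]; field_simp
      rw [mul_assoc, ← mul_pow, this, mul_pow]; ring

lemma hasShiftedForm_expDelta_genusZero {θ : ℝ} (hθ : 0 ≤ θ) {l : ℕ} {β : ℕ → ℝ}
    (hβ : ∀ j, 0 ≤ β j) (hs : Summable β) (hdiff : Differentiable ℂ (genusZero l β)) :
    HasShiftedForm (expDelta 1 θ (genusZero l β)) ∧ expDelta 1 θ (genusZero l β) 1 ≠ 0 := by
  obtain ⟨K, hK⟩ := exists_coeff_bound_genusZero hβ hs hdiff (d := 1 / 2) (by norm_num)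
  have hint (z : ℂ) := (integrable_and_hasSum_expDelta hθ (by norm_num) (by norm_num) hK
    (hasSum_iteratedDeriv hdiff) z).1
  have hlim (z : ℂ) : Tendsto (fun n => Polynomial.aeval z (expPoly θ (truncPoly l β n))) atTop
      (𝓝 (expDelta 1 θ (genusZero l β) z)) := by
    simp only [← expDelta_aeval hθ, expDelta]
    refine Tendsto.const_mul _ (Tendsto.add ?_ ?_)
    · split_ifs
      · exact tendsto_truncPoly l hs 0
      · exact tendsto_const_nhds
    · refine tendsto_integral_of_dominated_convergence
        (fun s => ‖expDeltaIntegrand 1 θ (genusZero l β) z s‖)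
        (fun n => (integrable_expDeltaIntegrand_aeval hθ (truncPoly l β n) z).1) (hint z).norm
        (fun n => ?_) ?_
      · refine (ae_restrict_iff' measurableSet_Ioi).2 (.of_forall fun s hs' => ?_)
        simp only [expDeltaIntegrand, norm_mul]
        refine mul_le_mul_of_nonneg_left ?_ (by positivity)
        have := norm_truncPoly_le l hβ hs (le_of_lt hs') n
        simpa using this
      · refine .of_forall fun s => ?_
        exact (tendsto_truncPoly l hs _).const_mul _
  have h1 : expDelta 1 θ (genusZero l β) 1 ≠ 0 := by
    have e1 := ((Complex.continuous_re.tendsto _).comp (hlim 1))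
    have e2 := ge_of_tendsto' e1 (b := 1) fun n => by
      simp only [Function.comp_apply, aeval_one_eq, Complex.ofReal_re]
      exact one_le_eval_expPoly_truncPoly hθ l hβ n
    intro h0
    rw [h0, Complex.zero_re] at e2
    norm_num at e2
  exact ⟨HasShiftedForm.of_tendsto (fun n => hasShiftedForm_expPoly_truncPoly hθ l hβ n) hlim h1,
    h1⟩

/-- The exponential rate of a Laguerre entire function is at most its exponential type. -/
lemma HasLaguerreForm.rate_le {α : ℝ} {f : ℂ → ℂ} (hf : HasLaguerreForm α f) {z₀ : ℂ}
    (hz₀ : f z₀ ≠ 0) {K d : ℝ} (h : ∀ z, ‖f z‖ ≤ K * Real.exp (d * ‖z‖)) : α ≤ d := by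
  obtain ⟨-, C, l, β, -, hβ, hs, hf⟩ := hf
  have hC : 0 < ‖C‖ := by
    rw [norm_pos_iff]
    rintro rfl
    exact hz₀ (by simp [hf])
  by_contra! hlt
  have hlow (x : ℝ) (hx : 1 ≤ x) : ‖C‖ * Real.exp (α * x) ≤ K * Real.exp (d * x) := by
    have hx0 : 0 ≤ x := by linarith
    have h1 := h x
    have hsx : Summable fun j => β j * x := hs.mul_right x
    have h2 : ∏' j, (1 + (β j : ℂ) * x) = ((∏' j, (1 + β j * x) : ℝ) : ℂ) := by
      rw [← tprod_one_add_ofReal hsx]; push_cast; rfl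
    have h3 := one_add_tsum_le_tprod (fun j => mul_nonneg (hβ j) hx0) hsx
    have h4 : 0 ≤ ∑' j, β j * x := tsum_nonneg fun j => mul_nonneg (hβ j) hx0
    rw [hf, h2, Complex.norm_of_nonneg hx0, norm_mul, norm_mul, norm_mul, norm_pow,
      Complex.norm_of_nonneg hx0, Complex.norm_of_nonneg (by linarith), ← Complex.ofReal_mul,
      Complex.norm_exp_ofReal] at h1
    refine le_trans ?_ h1
    have h5 : 1 ≤ x ^ l := one_le_pow₀ hx
    calc ‖C‖ * Real.exp (α * x) = ‖C‖ * 1 * Real.exp (α * x) * 1 := by ring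
      _ ≤ _ := by gcongr; linarith
  have hlim : Tendsto (fun x : ℝ => K * Real.exp (-((α - d) * x))) atTop (𝓝 0) := by
    have := (Real.tendsto_exp_neg_atTop_nhds_zero.comp
      (tendsto_id.const_mul_atTop (sub_pos.2 hlt))).const_mul K
    simpa using this
  have h2 : ‖C‖ ≤ 0 := by
    refine ge_of_tendsto hlim ?_
    filter_upwards [eventually_ge_atTop 1] with x hx
    have h3 := mul_le_mul_of_nonneg_right (hlow x hx) (Real.exp_pos (-(α * x))).le
    have e1 : Real.exp (α * x) * Real.exp (-(α * x)) = 1 := by rw [← Real.exp_add]; simp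
    have e2 : Real.exp (d * x) * Real.exp (-(α * x)) = Real.exp (-((α - d) * x)) := by
      rw [← Real.exp_add]; ring_nf
    rwa [mul_assoc, e1, mul_one, mul_assoc, e2] at h3
  linarith

/-- `exp(Δ_θ)` maps Laguerre entire functions of genus zero to Laguerre entire functions of genus
zero. -/
lemma hasLaguerreForm_expDelta_genusZero {θ : ℝ} (hθ : 0 ≤ θ) {l : ℕ} {β : ℕ → ℝ}
    (hβ : ∀ j, 0 ≤ β j) (hs : Summable β) (hdiff : Differentiable ℂ (genusZero l β)) :
    HasLaguerreForm 0 (expDelta 1 θ (genusZero l β)) := by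
  obtain ⟨h1, h2⟩ := hasShiftedForm_expDelta_genusZero hθ hβ hs hdiff
  have hgrow (e : ℝ) (he : 0 < e) : ∃ g : ℕ → ℂ, ∃ K : ℝ,
      (∀ z, HasSum (fun i => g i * z ^ i) (expDelta 1 θ (genusZero l β) z)) ∧
      ∀ i, ‖g i‖ ≤ K * (e ^ i / i.factorial) := by
    obtain ⟨K, hK⟩ := exists_coeff_bound_genusZero hβ hs hdiff (d := e / (1 + e)) (by positivity)
    have e1 : 1 - e / (1 + e) = 1 / (1 + e) := by field_simp; ring
    obtain ⟨g, hg, hgb⟩ := exists_hasSum_expDelta hθ (by positivity)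
      (by rw [← sub_pos, e1]; positivity) hK (hasSum_iteratedDeriv hdiff)
    have e2 : e / (1 + e) / (1 - e / (1 + e)) = e := by rw [e1]; field_simp
    rw [e2] at hgb
    exact ⟨g, _, hg, hgb⟩
  obtain ⟨g, K, hg, -⟩ := hgrow 1 one_pos
  obtain ⟨α, hα, hL⟩ := h1.exists_hasLaguerreForm (differentiable_and_iteratedDeriv_of_hasSum hg).1
  -- The image has type at most e for every e > 0, since e/(1 + e) is carried to e.
  have hα0 : α ≤ 0 := le_of_forall_pos_le_add fun e he => by
    obtain ⟨g, K, hg, hgb⟩ := hgrow e he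
    rw [zero_add]
    exact hL.rate_le h2 (norm_le_exp_of_hasSum hgb hg)
  rwa [le_antisymm hα0 hα] at hL

lemma HasLaguerreForm.exp_mul_comp {α₀ : ℝ} {G : ℂ → ℂ} (hG : HasLaguerreForm α₀ G) {κ : ℝ}
    (hκ : 0 ≤ κ) (α : ℝ) (A : ℂ) :
    HasLaguerreForm (α + α₀ * κ) fun z => A * Complex.exp (α * z) * G (κ * z) := by
  obtain ⟨hd, C, l, β, h1, h2, h3, h4⟩ := hG
  refine ⟨by fun_prop, A * C * κ ^ l, l, fun j => β j * κ,
    fun i j hij => mul_le_mul_of_nonneg_right (h1 hij) hκ, fun j => mul_nonneg (h2 j) hκ,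
    h3.mul_right κ, fun z => ?_⟩
  dsimp only
  rw [h4]
  have e1 : Complex.exp ((α + α₀ * κ : ℝ) * z) =
      Complex.exp (α * z) * Complex.exp (α₀ * (κ * z)) := by
    rw [← Complex.exp_add]; push_cast; ring_nf
  have e2 : ∏' j, (1 + ((β j * κ : ℝ) : ℂ) * z) = ∏' j, (1 + (β j : ℂ) * (κ * z)) :=
    tprod_congr fun j => by push_cast; ring
  rw [e1, e2, mul_pow]
  ring

/-- Every Laguerre entire function is an exponential times one of genus zero. -/
lemma HasLaguerreForm.exists_genusZero {α : ℝ} {f : ℂ → ℂ} (hf : HasLaguerreForm α f) :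
    ∃ (C : ℂ) (l : ℕ) (β : ℕ → ℝ), (∀ j, 0 ≤ β j) ∧ Summable β ∧
      Differentiable ℂ (genusZero l β) ∧ f = fun z => C * Complex.exp (α * z) * genusZero l β z := by
  obtain ⟨hd, C, l, β, -, h2, h3, h4⟩ := hf
  by_cases hC : C = 0
  -- For C = 0 the product cannot be recovered from f, so its differentiability is not available;
  -- trivial data replace it.
  · refine ⟨0, 0, fun _ => 0, fun _ => le_rfl, summable_zero, ?_, ?_⟩
    · have : genusZero 0 (fun _ => 0) = fun _ => 1 := by ext z; simp [genusZero]
      rw [this]; fun_prop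
    · ext z; simp [h4, hC]
  · refine ⟨C, l, β, h2, h3, ?_, ?_⟩
    · have : genusZero l β = fun z => C⁻¹ * Complex.exp (-(α * z)) * f z := by
        ext z
        rw [h4, genusZero, Complex.exp_neg]
        generalize ∏' j, (1 + (β j : ℂ) * z) = P
        have := Complex.exp_ne_zero (α * z)
        field_simp
      rw [this]; fun_prop
    · ext z; rw [h4, genusZero]; ring

lemma genusZero_comp_mul (l : ℕ) (β : ℕ → ℝ) (κ : ℝ) (z : ℂ) :
    genusZero l β (κ * z) = κ ^ l * genusZero l (fun j => β j * κ) z := by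
  simp only [genusZero, mul_pow]
  rw [mul_assoc]
  congr 2
  exact tprod_congr fun j => by push_cast; ring

lemma expDelta_const_mul (a θ : ℝ) (C : ℂ) (f : ℂ → ℂ) (z : ℂ) :
    expDelta a θ (fun w => C * f w) z = C * expDelta a θ f z := by
  have h : ∫ s in Ioi (0 : ℝ), expDeltaIntegrand a θ (fun w => C * f w) z s =
      C * ∫ s in Ioi (0 : ℝ), expDeltaIntegrand a θ f z s := by
    rw [← integral_const_mul]
    congr 1
    ext s
    simp only [expDeltaIntegrand]
    ring
  rw [expDelta, expDelta, h]
  split_ifs <;> ring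

/-! ### The exponential factor -/

section ExpFactor

variable {a α lam : ℝ} (ha : 0 < a) (hl : 0 < lam) (hlam : lam * (1 - a * α) = 1)

-- Under s = λt the exponent -s + αas becomes -t, because λ(1 - aα) = 1.
include ha hl hlam in
lemma expDeltaIntegrand_exp_mul (θ : ℝ) (h : ℂ → ℂ) (z : ℂ) {t : ℝ} (ht : 0 < t) :
    expDeltaIntegrand a θ (fun w => Complex.exp (α * w) * h w) z (lam * t) =
      ((lam ^ (θ - 1) : ℝ) : ℂ) * expDeltaIntegrand (a * lam) θ h (lam ^ 2 * z) t := by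
  have ha' : (a : ℂ) ≠ 0 := by exact_mod_cast ha.ne'
  have hl' : (lam : ℂ) ≠ 0 := by exact_mod_cast hl.ne'
  have hlam' : (lam : ℂ) * (1 - a * α) = 1 := by exact_mod_cast hlam
  have e1 : ((lam * t : ℝ) : ℂ) * z / a = t * (lam ^ 2 * z) / ((a * lam : ℝ) : ℂ) := by
    push_cast; field_simp
  have e2 : (a : ℂ) * ((lam * t : ℝ) : ℂ) = ((a * lam : ℝ) : ℂ) * t := by push_cast; ring
  have e3 : ((Real.exp (-(lam * t)) : ℝ) : ℂ) * Complex.exp (α * (((a * lam : ℝ) : ℂ) * t)) =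
      ((Real.exp (-t) : ℝ) : ℂ) := by
    push_cast
    rw [← Complex.exp_add]
    congr 1
    linear_combination (-(t : ℂ)) * hlam'
  simp only [expDeltaIntegrand, e1, e2, Real.mul_rpow hl.le ht.le]
  generalize ((a * lam : ℝ) : ℂ) = P at e3 ⊢
  simp only [Complex.ofReal_mul]
  linear_combination (((lam ^ (θ - 1) : ℝ) : ℂ) * ((t ^ (θ - 1) : ℝ) : ℂ) *
    wSeries θ (t * (lam ^ 2 * z) / P) * h (P * t)) * e3

include ha hl hlam in
lemma integrableOn_expDeltaIntegrand_exp_mul (θ : ℝ) (h : ℂ → ℂ) (z : ℂ)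
    (hi : IntegrableOn (expDeltaIntegrand (a * lam) θ h (lam ^ 2 * z)) (Ioi 0)) :
    IntegrableOn (expDeltaIntegrand a θ (fun w => Complex.exp (α * w) * h w) z) (Ioi 0) := by
  have := integrableOn_Ioi_comp_mul_left_iff
    (expDeltaIntegrand a θ (fun w => Complex.exp (α * w) * h w) z) 0 hl
  rw [mul_zero] at this
  rw [← this]
  have hi' : IntegrableOn (fun t => ((lam ^ (θ - 1) : ℝ) : ℂ) *
      expDeltaIntegrand (a * lam) θ h (lam ^ 2 * z) t) (Ioi 0) := hi.const_mul _
  exact hi'.congr_fun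
    (fun t ht => (expDeltaIntegrand_exp_mul ha hl hlam θ h z ht).symm) measurableSet_Ioi

-- λ^θ is the Jacobian λ times λ^{θ-1}; at θ = 0 it equals 1, in agreement with the point mass at 0.
-- The outer exponentials match by αλ - λ/a = -1/a.
include ha hl hlam in
lemma expDelta_exp_mul (θ : ℝ) (h : ℂ → ℂ) (z : ℂ) :
    expDelta a θ (fun w => Complex.exp (α * w) * h w) z =
      ((lam ^ θ : ℝ) : ℂ) * Complex.exp ((α * lam : ℝ) * z) *
        expDelta (a * lam) θ h (lam ^ 2 * z) := by
  have ha' : (a : ℂ) ≠ 0 := by exact_mod_cast ha.ne'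
  have hl' : (lam : ℂ) ≠ 0 := by exact_mod_cast hl.ne'
  have hlam' : (lam : ℂ) * (1 - a * α) = 1 := by exact_mod_cast hlam
  have h1 := integral_comp_mul_left_Ioi'
    (expDeltaIntegrand a θ (fun w => Complex.exp (α * w) * h w) z) 0 hl
  rw [mul_zero, setIntegral_congr_fun measurableSet_Ioi fun t ht =>
    expDeltaIntegrand_exp_mul ha hl hlam θ h z ht, integral_const_mul] at h1
  have e1 : Complex.exp (-z / a) = Complex.exp ((α * lam : ℝ) * z) *
      Complex.exp (-(lam ^ 2 * z) / ((a * lam : ℝ) : ℂ)) := by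
    rw [← Complex.exp_add]
    congr 1
    push_cast
    field_simp
    linear_combination z * hlam'
  have e2 : (lam : ℂ) * ((lam ^ (θ - 1) : ℝ) : ℂ) = ((lam ^ θ : ℝ) : ℂ) := by
    rw [Real.rpow_sub_one hl.ne']
    push_cast
    field_simp
  rw [Complex.real_smul, ← mul_assoc, e2] at h1
  rw [expDelta, expDelta, ← h1, e1]
  split_ifs with h0
  · subst h0
    simp
    ring
  · ring

end ExpFactor

/-- The image of a function in the Laguerre class with rate `α < 1 / a` is in the Laguerre class
with rate `α / (1 - a α)`. -/
lemma HasLaguerreForm.expDelta {a θ α : ℝ} (ha : 0 < a) (hθ : 0 ≤ θ) (hα : a * α < 1) {f : ℂ → ℂ}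
    (hf : HasLaguerreForm α f) :
    (∀ z : ℂ, IntegrableOn (expDeltaIntegrand a θ f z) (Ioi 0)) ∧
      HasLaguerreForm (α * (1 - a * α)⁻¹) (expDelta a θ f) := by
  obtain ⟨C, l, β, h2, h3, h4, rfl⟩ := hf.exists_genusZero
  have h1 : 0 < 1 - a * α := by linarith
  set lam := (1 - a * α)⁻¹ with hlamdef
  have hl : 0 < lam := inv_pos.2 h1
  have hlam : lam * (1 - a * α) = 1 := inv_mul_cancel₀ h1.ne'
  have hal : 0 < a * lam := by positivity
  have e1 : (fun z => C * Complex.exp (α * z) * genusZero l β z) =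
      fun z => Complex.exp (α * z) * (C * genusZero l β z) := by ext z; ring
  set β' : ℕ → ℝ := fun j => β j * (a * lam)
  have hβ' (j : ℕ) : 0 ≤ β' j := mul_nonneg (h2 j) hal.le
  have hsβ' : Summable β' := h3.mul_right _
  have hne : ((a * lam : ℝ) : ℂ) ^ l ≠ 0 := pow_ne_zero _ (by exact_mod_cast hal.ne')
  have hdiff : Differentiable ℂ (genusZero l β') := by
    have : genusZero l β' = fun z =>
        (((a * lam : ℝ) : ℂ) ^ l)⁻¹ * genusZero l β ((a * lam : ℝ) * z) := by
      ext z
      rw [genusZero_comp_mul, inv_mul_cancel_left₀ hne]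
    rw [this]
    exact (h4.comp (differentiable_id.const_mul _)).const_mul _
  have e2 : (fun w : ℂ => C * genusZero l β ((a * lam : ℝ) * w)) =
      fun w => (C * ((a * lam : ℝ) : ℂ) ^ l) * genusZero l β' w := by
    ext w; rw [genusZero_comp_mul]; ring
  rw [e1]
  constructor
  · intro z
    refine integrableOn_expDeltaIntegrand_exp_mul ha hl hlam θ _ z ?_
    rw [expDeltaIntegrand_scale, e2]
    obtain ⟨K, hK⟩ := exists_coeff_bound_genusZero hβ' hsβ' hdiff (d := 1 / 2) (by norm_num)
    have := ((integrable_and_hasSum_expDelta hθ (by norm_num) (by norm_num) hK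
      (hasSum_iteratedDeriv hdiff) (lam ^ 2 * z / (a * lam : ℝ))).1).const_mul
        (C * ((a * lam : ℝ) : ℂ) ^ l)
    refine this.congr (.of_forall fun s => ?_)
    simp only [expDeltaIntegrand]
    ring
  · have h5 := (hasLaguerreForm_expDelta_genusZero hθ hβ' hsβ' hdiff).exp_mul_comp
      (κ := lam / a) (by positivity) (α * lam) (((lam ^ θ : ℝ) : ℂ) * (C * ((a * lam : ℝ) : ℂ) ^ l))
    rw [zero_mul, add_zero] at h5
    convert h5 using 1
    ext z
    rw [expDelta_exp_mul ha hl hlam, expDelta_scale, e2, expDelta_const_mul]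
    have hl' : (lam : ℂ) ≠ 0 := by exact_mod_cast hl.ne'
    have ha' : (a : ℂ) ≠ 0 := by exact_mod_cast ha.ne'
    have e3 : (lam : ℂ) ^ 2 * z / ((a * lam : ℝ) : ℂ) = ((lam / a : ℝ) : ℂ) * z := by
      push_cast; field_simp
    rw [e3]
    ring

/-- The zero function has every rate, so its given rate may be too large; it is replaced by 0. -/
lemma exists_rate_le_of_mem_entireB {α d : ℝ} (hα : 0 ≤ α) (hd : 0 < d) {f : ℂ → ℂ}
    (hf : HasLaguerreForm α f) (hfd : f ∈ entireB d) :
    ∃ α', 0 ≤ α' ∧ α' ≤ d ∧ HasLaguerreForm α' f := by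
  by_cases h : ∃ z, f z ≠ 0
  · obtain ⟨z, hz⟩ := h
    obtain ⟨K, hK⟩ := norm_iteratedDeriv_le_of_mem_entireB hd hfd
    exact ⟨α, hα, hf.rate_le hz (norm_le_exp_of_hasSum hK (hasSum_iteratedDeriv hf.1)), hf⟩
  · push Not at h
    exact ⟨0, le_rfl, hd.le, hf.1, 0, 0, fun _ => 0, antitone_const, fun _ => le_rfl,
      summable_zero, fun z => by simp [h z]⟩
end

theorem theorem4 (a θ : ℝ) (ha : 0 < a) (hθ : 0 ≤ θ) :
    (∀ b : ℝ, 0 ≤ b → b < 1 / a → ∀ f ∈ laguerrePlusIn b,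
      (∀ z : ℂ, IntegrableOn (expDeltaIntegrand a θ f z) (Ioi 0)) ∧
      (∀ z : ℂ, HasSum (deltaSeriesTerm θ (fun w : ℂ => Complex.exp ((a : ℂ) * w)) f z)
        (expDelta a θ f z)) ∧
      expDelta a θ f ∈ laguerrePlusIn (b / (1 - a * b))) ∧
    (∀ f ∈ laguerreMinus,
      (∀ z : ℂ, IntegrableOn (expDeltaIntegrand a θ f z) (Ioi 0)) ∧
      expDelta a θ f ∈ laguerreMinus) := by
  constructor
  · intro b hb hba f hf
    obtain ⟨⟨α, hα, hfα⟩, hfA⟩ := hf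
    have h := integrableOn_and_hasSum_expDelta_of_mem_entireA ha hθ hb hba hfA
    refine ⟨fun z => (h z).1, fun z => (h z).2, ?_, expDelta_mem_entireA ha hθ hb hba hfA⟩
    obtain ⟨d, hbd, hd⟩ := exists_between hba
    obtain ⟨α', h0, hle, hα'⟩ :=
      exists_rate_le_of_mem_entireB hα (hb.trans_lt hbd) hfα (hfA d hbd)
    have haα : a * α' < 1 := by
      rw [mul_comm, ← lt_div_iff₀ ha]
      exact hle.trans_lt hd
    exact ⟨_, mul_nonneg h0 (inv_nonneg.2 (by linarith)), (hα'.expDelta ha hθ haα).2⟩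
  · rintro f ⟨α, hα, hf⟩
    have haα : a * α < 0 := mul_neg_of_pos_of_neg ha hα
    obtain ⟨h1, h2⟩ := hf.expDelta ha hθ (by linarith)
    exact ⟨h1, _, mul_neg_of_neg_of_pos hα (inv_pos.2 (by linarith)), h2⟩
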